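/- Theorem 1.1. Let $n\ge 2$ and $G=\mathbb{R}^n\setminus\{0\}$. For $x,y\in G$ let $$k_G(x,y)=\inf_{\gamma}\int_\gamma\frac{|dz|}{d(z,\partial G)},$$ where $d(z,\partial G)=|z|$ is the Euclidean distance from $z$ to $\partial G=\{0\}$ and the infimum is over all rectifiable curves $\gamma$ in $G$ joining $x$ and $y$, and let $D_G(x,M)=\{z\in G: k_G(x,z)<M\}$ be the quasihyperbolic ball. An open set $D$ is called strictly convex if for any two distinct points of $\overline{D}$ the open segment between them lies in $D$. A set $D$ is starlike with respect to $x\in D$ if for each $y\in D$ the line segment from $x$ to $y$ is contained in $D$. A domain $D$ is strictly starlike with respect to $x\in D$ if $D$ is bounded and each ray from $x$ meets $\partial D$ at exactly one point. The equation $$\cos\sqrt{p^2-1}+\sqrt{p^2-1}\,\sin\sqrt{p^2-1}=e^{-1}$$ has exactly one solution $p=\kappa$ in $[1,\pi]$, and $\kappa\approx 2.83297$ (correct to five decimals, $|\kappa-2.83297|\le 5\cdot 10^{-6}$). For every $n\ge2$ and every $x\in\mathbb{R}^n\setminus\{0\}$: 1) the quasihyperbolic ball $D_{\mathbb{R}^n\setminus\{0\}}(x,M)$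 is strictly convex for $M\in(0,1]$ and is not convex for $M>1$; 2) the quasihyperbolic ball $D_{\mathbb{R}^n\setminus\{0\}}(x,M)$ is a domain that is strictly starlike with respect to $x$ for $M\in(0,\kappa]$, and it is not starlike with respect to $x$ for $M>\kappa$. -/

import Mathlib

open scoped ENNReal

section Curves

variable {E : Type*} [NormedAddCommGroup E]

/-- The rectifiable curves `γ : [0,1] → G` that join `x` to `y`: continuous maps of bounded
variation (that is, of finite length) with values in `G`. Only the values of `γ` on `[0,1]`
matter. -/
def rectifiableCurves (G : Set E) (x y : E) : Set (ℝ → E) :=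
  {γ | ContinuousOn γ (Set.Icc 0 1) ∧ BoundedVariationOn γ (Set.Icc 0 1) ∧
    Set.MapsTo γ (Set.Icc 0 1) G ∧ γ 0 = x ∧ γ 1 = y}

/-- The length of the curve `γ : [0,1] → E`. -/
noncomputable def curveLength (γ : ℝ → E) : ℝ :=
  (eVariationOn γ (Set.Icc 0 1)).toReal

/-- The line integral `∫_γ ρ |dz|` of a nonnegative density along a rectifiable curve
`γ : [0,1] → E`: the integral over `[0, ℓ]`, where `ℓ` is the length of `γ`, of `ρ` along the
parametrization of `γ` by arc length. -/
noncomputable def lineIntegral (ρ : E → ℝ≥0∞) (γ : ℝ → E) : ℝ≥0∞ :=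
  ∫⁻ s in Set.Icc 0 (curveLength γ), ρ (naturalParameterization γ (Set.Icc 0 1) 0 s)

/-- The quasihyperbolic distance of `G`: the infimum of `∫_γ |dz| / d(z, ∂G)` over all
rectifiable curves `γ` in `G` that join `x` to `y`. -/
noncomputable def quasihyperbolicDist (G : Set E) (x y : E) : ℝ≥0∞ :=
  ⨅ γ ∈ rectifiableCurves G x y, lineIntegral (fun z => (Metric.infEDist z (frontier G))⁻¹) γ

/-- The quasihyperbolic ball `D_G(x, M)`. -/
def quasihyperbolicBall (G : Set E) (x : E) (M : ℝ) : Set E :=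
  {z | z ∈ G ∧ quasihyperbolicDist G x z < ENNReal.ofReal M}

variable [NormedSpace ℝ E]

/-- A set `G` is strictly convex if the open segment between any two distinct points of its
closure lies in its interior. (In particular `G` is convex, and for open `G` its boundary contains
no segment. Mathlib's `StrictConvex` looks at end points in `G` only, hence for an open set it
says no more than convexity.) -/
def IsStrictlyConvex (G : Set E) : Prop :=
  ∀ y ∈ closure G, ∀ z ∈ closure G, y ≠ z → openSegment ℝ y z ⊆ interior G

/-- `G` is a bounded domain containing `x`, and each ray from `x` meets the boundary of `G` in
exactly one point. -/
def IsStrictlyStarlike (x : E) (G : Set E) : Prop :=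
  IsOpen G ∧ IsConnected G ∧ x ∈ G ∧ Bornology.IsBounded G ∧
    ∀ v : E, v ≠ 0 → ∃! y : E, y ∈ frontier G ∧ ∃ t : ℝ, 0 ≤ t ∧ y = x + t • v

end Curves

/-- The equation that defines the constant `κ`. -/
def KappaEquation (p : ℝ) : Prop :=
  Real.cos (Real.sqrt (p ^ 2 - 1)) + Real.sqrt (p ^ 2 - 1) * Real.sin (Real.sqrt (p ^ 2 - 1))
    = Real.exp (-1)

/-! In the half-plane bounded by the line `ℝx` and containing `z`, scaled so that `x` becomes `1`,
the point `z` is a complex number `planar x z` with nonnegative imaginary part, and `|dz| / |z|` is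
the Euclidean length element in the coordinate `log`. Hence the distance from `x` to `z` is `‖log
(planar x z)‖` (`quasihyperbolicDist_compl_zero`): folding `E` onto one half-plane is a contraction
up to scale, which gives the lower bound for every curve, and a logarithmic spiral attains it. The
ball is therefore the image under `exp` of a Euclidean disc, folded onto the upper half-plane
(`logBall`).

Convexity: at each point `w` with `‖log w‖ ≤ 1` the tangent line supports the region `‖log z‖ ≤ ‖log
w‖` strictly (`Complex.tangent_lt`). This comes from a second-order Taylor estimate of `exp` with
the sharp constant `1/2`. Since `Im (planar x z)` is a convex function of `z`, the planar fact
passes to `E` (`openSegment_norm_log_lt`). For `M > 1` the boundary is concave near the point `exp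
(-M) x` closest to the origin.

Starlikeness: a ray from `x` becomes `1 + t c`, and at `exp (r + i q)` the derivative of `‖log‖ ^ 2`
along it has the sign of `r e^r - r cos q + q sin q`. The minimum of `r e^r` is `-1/e`, at `r = -1`.
On the arc `r ^ 2 + q ^ 2 = p ^ 2`, `r ≤ 0`, `q ≥ π / 2`, the remaining terms are also minimal at `r
= -1`, with value `cosAddMulSin √(p ^ 2 - 1)`. So the sign can first fail when this value is `1/e`,
that is at `p = κ` (`radial_pos_or`). At `p = κ` the derivative vanishes at a single point, which
still leaves each ray only one boundary point; beyond `κ` it is negative at `r = -1`, and the ray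
re-enters the ball. -/

section Development

open Set Filter Topology MeasureTheory

/-! ### Arc length parametrization of rectifiable curves. -/

section CurveLength

variable {F : Type*} [MetricSpace F]

/-- The one-sided limits of the variation differ from its value by the jumps of `f`, and these
vanish. Continuity makes every arc length in `[0, ℓ]` an attained value. -/
theorem continuousOn_variationOnFromTo {f : ℝ → F} {s : Set ℝ} {a : ℝ} (ha : a ∈ s)
    (hf : ContinuousOn f s) (hb : LocallyBoundedVariationOn f s) :
    ContinuousOn (variationOnFromTo f s a) s := by
  intro t ht
  have h1 := variationOnFromTo.tendsto_left (a := a) ha ht hb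
    ((hf t ht).mono_left (nhdsWithin_mono t inter_subset_left))
  have h2 := variationOnFromTo.tendsto_right (a := a) ha ht hb
    ((hf t ht).mono_left (nhdsWithin_mono t inter_subset_left))
  rw [dist_self, sub_zero] at h1
  rw [dist_self, add_zero] at h2
  have h3 : ContinuousWithinAt (variationOnFromTo f s a) {t} t := continuousWithinAt_singleton
  have h4 : ContinuousWithinAt (variationOnFromTo f s a) ((s ∩ Iio t) ∪ (s ∩ Ioi t) ∪ {t}) t :=
    continuousWithinAt_union.2 ⟨continuousWithinAt_union.2 ⟨h1, h2⟩, h3⟩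
  refine h4.mono fun r hr => ?_
  rcases lt_trichotomy r t with h | h | h
  · exact Or.inl (Or.inl ⟨hr, h⟩)
  · exact Or.inr h
  · exact Or.inl (Or.inr ⟨hr, h⟩)

theorem dist_le_variationOnFromTo_sub {f : ℝ → F} {s : Set ℝ} {a b c : ℝ} (ha : a ∈ s)
    (hb : b ∈ s) (hc : c ∈ s) (hbc : b ≤ c) (hf : LocallyBoundedVariationOn f s) :
    dist (f b) (f c) ≤ variationOnFromTo f s a c - variationOnFromTo f s a b := by
  rw [variationOnFromTo.sub_right hf ha hc hb, variationOnFromTo.eq_of_le f s hbc, dist_edist]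
  exact ENNReal.toReal_mono (hf b c hb hc)
    (eVariationOn.edist_le f ⟨hb, le_rfl, hbc⟩ ⟨hc, hbc, le_rfl⟩)

theorem naturalParameterization_variationOnFromTo {f : ℝ → F} {s : Set ℝ} {a b : ℝ}
    (hf : LocallyBoundedVariationOn f s) (ha : a ∈ s) (hb : b ∈ s) :
    naturalParameterization f s a (variationOnFromTo f s a b) = f b :=
  edist_eq_zero.1 (edist_naturalParameterization_eq_zero hf ha hb)

end CurveLength

section CurvesInE

variable {E : Type*} [NormedAddCommGroup E]

theorem variationOnFromTo_one (γ : ℝ → E) :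
    variationOnFromTo γ (Icc 0 1) 0 1 = curveLength γ := by
  rw [variationOnFromTo.eq_of_le _ _ zero_le_one, inter_self, curveLength]

theorem exists_variationOnFromTo_eq {γ : ℝ → E} (hc : ContinuousOn γ (Icc 0 1))
    (hb : BoundedVariationOn γ (Icc 0 1)) {a b s : ℝ} (ha : a ∈ Icc (0 : ℝ) 1)
    (hb1 : b ∈ Icc (0 : ℝ) 1) (hab : a ≤ b)
    (hs : s ∈ Icc (variationOnFromTo γ (Icc 0 1) 0 a) (variationOnFromTo γ (Icc 0 1) 0 b)) :
    ∃ t ∈ Icc a b, variationOnFromTo γ (Icc 0 1) 0 t = s := by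
  have h0 : (0 : ℝ) ∈ Icc (0 : ℝ) 1 := ⟨le_rfl, zero_le_one⟩
  have hV := continuousOn_variationOnFromTo h0 hc hb.locallyBoundedVariationOn
  exact intermediate_value_Icc hab
    (hV.mono fun r hr => ⟨ha.1.trans hr.1, hr.2.trans hb1.2⟩) hs

theorem exists_naturalParameterization_eq {γ : ℝ → E} (hc : ContinuousOn γ (Icc 0 1))
    (hb : BoundedVariationOn γ (Icc 0 1)) {s : ℝ} (hs : s ∈ Icc 0 (curveLength γ)) :
    ∃ t ∈ Icc (0 : ℝ) 1, variationOnFromTo γ (Icc 0 1) 0 t = s ∧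
      naturalParameterization γ (Icc 0 1) 0 s = γ t := by
  have h0 : (0 : ℝ) ∈ Icc (0 : ℝ) 1 := ⟨le_rfl, zero_le_one⟩
  have h1 : (1 : ℝ) ∈ Icc (0 : ℝ) 1 := ⟨zero_le_one, le_rfl⟩
  obtain ⟨t, ht, rfl⟩ := exists_variationOnFromTo_eq hc hb h0 h1 zero_le_one (s := s)
    (by rwa [variationOnFromTo_one, variationOnFromTo.self])
  exact ⟨t, ht, rfl, naturalParameterization_variationOnFromTo hb.locallyBoundedVariationOn h0 ht⟩

theorem lipschitzOnWith_naturalParameterization {γ : ℝ → E} (hc : ContinuousOn γ (Icc 0 1))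
    (hb : BoundedVariationOn γ (Icc 0 1)) :
    LipschitzOnWith 1 (naturalParameterization γ (Icc 0 1) 0) (Icc 0 (curveLength γ)) := by
  have h0 : (0 : ℝ) ∈ Icc (0 : ℝ) 1 := ⟨le_rfl, zero_le_one⟩
  refine LipschitzOnWith.of_dist_le_mul fun s hs s' hs' => ?_
  obtain ⟨t, ht, rfl, hg⟩ := exists_naturalParameterization_eq hc hb hs
  obtain ⟨t', ht', rfl, hg'⟩ := exists_naturalParameterization_eq hc hb hs'
  rw [hg, hg', NNReal.coe_one, one_mul]
  rcases le_total t t' with h | h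
  · rw [dist_comm (variationOnFromTo _ _ _ _)]
    exact (dist_le_variationOnFromTo_sub h0 ht ht' h hb.locallyBoundedVariationOn).trans
      (le_abs_self _)
  · rw [dist_comm]
    exact (dist_le_variationOnFromTo_sub h0 ht' ht h hb.locallyBoundedVariationOn).trans
      (le_abs_self _)

end CurvesInE

/-! ### Growth of the logarithm along a Lipschitz curve in the closed upper half-plane. -/

section LogAlongCurve

theorem Complex.continuousWithinAt_log_im_nonneg {z : ℂ} (hz : z ≠ 0) (_ : 0 ≤ z.im) :
    ContinuousWithinAt Complex.log {w | 0 ≤ w.im} z := by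
  by_cases hs : z ∈ Complex.slitPlane
  · exact (continuousAt_clog hs).continuousWithinAt
  · rw [Complex.mem_slitPlane_iff, not_or, not_lt, not_not] at hs
    have hre : z.re < 0 := lt_of_le_of_ne hs.1 fun h0 => hz (Complex.ext h0 hs.2)
    exact Complex.continuousWithinAt_log_of_re_neg_of_im_zero hre hs.2

/-- Both arguments lie in `[0, π]`, so their difference can leave `(-π, π]` only by being `-π`; then
`w / z` would be a negative real. -/
theorem Complex.log_sub_log_eq_log_div {z w : ℂ} (hz : z ≠ 0) (hw : w ≠ 0) (hzi : 0 ≤ z.im)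
    (hwi : 0 ≤ w.im) (h : w / z ∈ Complex.slitPlane) :
    Complex.log w - Complex.log z = Complex.log (w / z) := by
  have hw1 := Complex.arg_nonneg_iff.2 hwi
  have hz1 := Complex.arg_nonneg_iff.2 hzi
  have hw2 := Complex.arg_le_pi w
  have hz2 := Complex.arg_le_pi z
  have hexp : Complex.exp (Complex.log w - Complex.log z) = w / z := by
    rw [Complex.exp_sub, Complex.exp_log hw, Complex.exp_log hz]
  rcases (show -Real.pi ≤ w.arg - z.arg by linarith).eq_or_lt with h1 | h1
  · exfalso
    have e : Complex.log w - Complex.log z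
        = (Real.log ‖w‖ - Real.log ‖z‖ : ℝ) - Real.pi * Complex.I := by
      apply Complex.ext
      · simp [Complex.log_re]
      · simp [Complex.log_im]; linarith
    have h2 : w / z = ((-Real.exp (Real.log ‖w‖ - Real.log ‖z‖) : ℝ) : ℂ) := by
      rw [← hexp, e, Complex.exp_sub, Complex.exp_pi_mul_I, div_neg, div_one, Complex.ofReal_neg,
        Complex.ofReal_exp]
    rw [h2, Complex.ofReal_mem_slitPlane] at h
    exact absurd h (not_lt.2 (neg_nonpos.2 (Real.exp_pos _).le))
  · rw [← hexp, Complex.log_exp]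
    · simpa [Complex.log_im] using h1
    · simp only [Complex.sub_im, Complex.log_im]; linarith

/-- Dividing by `z` moves the base point to `1`, away from the cut, so the estimate also holds for
`z` on the negative axis, where `log` has no derivative. -/
theorem Complex.eventually_norm_log_sub_log_le {z : ℂ} (hz : z ≠ 0) (hzi : 0 ≤ z.im) {r : ℝ}
    (hr : ‖z‖⁻¹ < r) :
    ∀ᶠ w in 𝓝 z, 0 ≤ w.im → ‖Complex.log w - Complex.log z‖ ≤ r * ‖w - z‖ := by
  have h1 : z / z ∈ Complex.slitPlane := by rw [div_self hz]; exact Complex.one_mem_slitPlane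
  have hd : HasDerivAt (fun w => Complex.log (w / z)) (1 / z / (z / z)) z :=
    ((hasDerivAt_id z).div_const z).clog h1
  have hsl : ∀ᶠ w in 𝓝 z, w / z ∈ Complex.slitPlane :=
    (continuousAt_id.div_const z).eventually_mem (Complex.isOpen_slitPlane.mem_nhds h1)
  have ho := (hasDerivAt_iff_isLittleO.1 hd).def (sub_pos.2 hr)
  filter_upwards [hsl, ho, isOpen_ne.mem_nhds hz] with w hw1 hw2 hw0 hwi
  rw [Complex.log_sub_log_eq_log_div hz hw0 hzi hwi hw1]
  simp only [div_self hz, Complex.log_one, sub_zero, smul_eq_mul, div_one] at hw2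
  calc ‖Complex.log (w / z)‖
      = ‖(Complex.log (w / z) - (w - z) * (1 / z)) + (w - z) * (1 / z)‖ := by ring_nf
    _ ≤ (r - ‖z‖⁻¹) * ‖w - z‖ + ‖(w - z) * (1 / z)‖ :=
        (norm_add_le _ _).trans (add_le_add hw2 le_rfl)
    _ = r * ‖w - z‖ := by rw [norm_mul, norm_div, norm_one]; ring

/-- The curve is only Lipschitz, so instead of differentiating, right slopes are compared with the
derivative of the integral. -/
theorem Complex.norm_log_sub_norm_log_le_integral {c : ℝ → ℂ} {K : NNReal}
    (hc : LipschitzWith K c) (h0 : ∀ t, c t ≠ 0) (hi : ∀ t, 0 ≤ (c t).im) {b : ℝ} (hb : 0 ≤ b) :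
    ‖Complex.log (c b)‖ - ‖Complex.log (c 0)‖ ≤ ∫ t in (0 : ℝ)..b, K / ‖c t‖ := by
  have hcont : Continuous fun t => K / ‖c t‖ :=
    continuous_const.div hc.continuous.norm fun t => norm_ne_zero_iff.2 (h0 t)
  have hlog : Continuous fun t => Complex.log (c t) := by
    refine continuous_iff_continuousAt.2 fun t => ?_
    exact (Complex.continuousWithinAt_log_im_nonneg (h0 t) (hi t)).tendsto.comp
      (tendsto_nhdsWithin_iff.2 ⟨hc.continuous.continuousAt, Eventually.of_forall hi⟩)
  have hB : ∀ t, HasDerivAt (fun t => ∫ r in (0 : ℝ)..t, K / ‖c r‖) (K / ‖c t‖) t := fun t =>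
    intervalIntegral.integral_hasDerivAt_right (hcont.intervalIntegrable _ _)
      hcont.aestronglyMeasurable.stronglyMeasurableAtFilter hcont.continuousAt
  refine image_le_of_liminf_slope_right_le_deriv_boundary
    (f := fun t => ‖Complex.log (c t)‖ - ‖Complex.log (c 0)‖) (a := 0) (b := b)
    (B := fun t => ∫ r in (0 : ℝ)..t, K / ‖c r‖) (B' := fun t => K / ‖c t‖)
    (hlog.norm.sub continuous_const).continuousOn (by simp)
    (fun t _ => (hB t).continuousAt.continuousWithinAt) (fun t _ => (hB t).hasDerivWithinAt)
    (fun t _ r hr => ?_) ⟨hb, le_rfl⟩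
  have hct : 0 < ‖c t‖ := norm_pos_iff.2 (h0 t)
  obtain ⟨q, hq1, hq2⟩ : ∃ q, ‖c t‖⁻¹ < q ∧ K * q < r := by
    have : ∀ᶠ q in 𝓝[>] (‖c t‖⁻¹), K * q < r :=
      (((continuous_const.mul continuous_id).tendsto _).mono_left nhdsWithin_le_nhds).eventually
        (gt_mem_nhds (by simpa [div_eq_mul_inv] using hr))
    obtain ⟨q, hq⟩ := (this.and self_mem_nhdsWithin).exists
    exact ⟨q, hq.2, hq.1⟩
  have hev := (hc.continuous.tendsto t).eventually
    (Complex.eventually_norm_log_sub_log_le (h0 t) (hi t) hq1)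
  refine Eventually.frequently ?_
  filter_upwards [nhdsWithin_le_nhds hev, self_mem_nhdsWithin] with s hs hts
  rw [mem_Ioi] at hts
  rw [slope_def_field, div_lt_iff₀ (sub_pos.2 hts)]
  have h1 := hs (hi s)
  have h2 : ‖c s - c t‖ ≤ K * (s - t) := by
    have := hc.dist_le_mul s t
    rwa [dist_eq_norm, Real.dist_eq, abs_of_pos (sub_pos.2 hts)] at this
  have hq0 : 0 ≤ q := (inv_nonneg.2 hct.le).trans hq1.le
  calc ‖Complex.log (c s)‖ - ‖Complex.log (c 0)‖ - (‖Complex.log (c t)‖ - ‖Complex.log (c 0)‖)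
      ≤ ‖Complex.log (c s) - Complex.log (c t)‖ := by
        linarith [norm_sub_norm_le (Complex.log (c s)) (Complex.log (c t))]
    _ ≤ q * (K * (s - t)) := h1.trans (mul_le_mul_of_nonneg_left h2 hq0)
    _ = (K * q) * (s - t) := by ring
    _ < r * (s - t) := mul_lt_mul_of_pos_right hq2 (sub_pos.2 hts)

end LogAlongCurve

/-! ### Upper bounds for line integrals by subdivision. -/

section Subdivision

variable {E : Type*} [NormedAddCommGroup E]

theorem variationOnFromTo_sub_le {γ : ℝ → E} (hb : BoundedVariationOn γ (Icc 0 1)) {a b : ℝ}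
    (ha : 0 ≤ a) (hab : a ≤ b) (hb1 : b ≤ 1) {K : NNReal} (hK : LipschitzOnWith K γ (Icc a b)) :
    variationOnFromTo γ (Icc 0 1) 0 b - variationOnFromTo γ (Icc 0 1) 0 a ≤ K * (b - a) := by
  have h0 : (0 : ℝ) ∈ Icc (0 : ℝ) 1 := ⟨le_rfl, zero_le_one⟩
  rw [variationOnFromTo.sub_right hb.locallyBoundedVariationOn h0 ⟨ha.trans hab, hb1⟩
    ⟨ha, hab.trans hb1⟩, variationOnFromTo.eq_of_le _ _ hab]
  refine ENNReal.toReal_le_of_le_ofReal (mul_nonneg K.2 (sub_nonneg.2 hab)) ?_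
  have h1 : eVariationOn (γ ∘ id) (Icc a b) ≤ K * eVariationOn (id : ℝ → ℝ) (Icc a b) :=
    hK.comp_eVariationOn_le (mapsTo_id _)
  have h2 : eVariationOn (id : ℝ → ℝ) (Icc a b ∩ Icc a b) = ENNReal.ofReal (id b - id a) :=
    MonotoneOn.eVariationOn_eq (monotone_id.monotoneOn _) ⟨le_rfl, hab⟩ ⟨hab, le_rfl⟩
  rw [inter_self] at h2
  calc eVariationOn γ (Icc 0 1 ∩ Icc a b) ≤ eVariationOn γ (Icc a b) :=
        eVariationOn.mono _ inter_subset_right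
    _ ≤ K * ENNReal.ofReal (b - a) := h1.trans (by rw [h2]; rfl)
    _ = ENNReal.ofReal (K * (b - a)) := by
        rw [ENNReal.ofReal_mul K.coe_nonneg, ENNReal.ofReal_coe_nnreal]

theorem lintegral_Icc_variation_le {γ : ℝ → E} (hc : ContinuousOn γ (Icc 0 1))
    (hb : BoundedVariationOn γ (Icc 0 1)) {a b : ℝ}
    (ha : 0 ≤ a) (hab : a ≤ b) (hb1 : b ≤ 1) {K : NNReal} (hK : LipschitzOnWith K γ (Icc a b))
    {ρ : E → ℝ≥0∞} {k : ℝ≥0∞} (hk : ∀ t ∈ Icc a b, ρ (γ t) ≤ k) :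
    ∫⁻ s in Icc (variationOnFromTo γ (Icc 0 1) 0 a) (variationOnFromTo γ (Icc 0 1) 0 b),
      ρ (naturalParameterization γ (Icc 0 1) 0 s) ≤ k * ENNReal.ofReal (K * (b - a)) := by
  have h0 : (0 : ℝ) ∈ Icc (0 : ℝ) 1 := ⟨le_rfl, zero_le_one⟩
  calc _ ≤ ∫⁻ _ in Icc (variationOnFromTo γ (Icc 0 1) 0 a)
          (variationOnFromTo γ (Icc 0 1) 0 b), k := by
        refine setLIntegral_mono' measurableSet_Icc fun s hs => ?_
        obtain ⟨t, ht, rfl⟩ := exists_variationOnFromTo_eq hc hb ⟨ha, hab.trans hb1⟩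
          ⟨ha.trans hab, hb1⟩ hab hs
        rw [naturalParameterization_variationOnFromTo hb.locallyBoundedVariationOn h0
          ⟨ha.trans ht.1, ht.2.trans hb1⟩]
        exact hk t ht
    _ ≤ _ := by
        rw [setLIntegral_const, Real.volume_Icc]
        gcongr
        exact variationOnFromTo_sub_le hb ha hab hb1 hK

/-- With `n` equal pieces the bounds sum to `D exp (c / n)`, which tends to `D`. This avoids
identifying the arc length parametrization of an explicit curve. -/
theorem lineIntegral_le_of_forall_Icc {γ : ℝ → E} (hc : ContinuousOn γ (Icc 0 1))
    (hb : BoundedVariationOn γ (Icc 0 1)) {ρ : E → ℝ≥0∞} {D c : ℝ}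
    (h : ∀ a b : ℝ, 0 ≤ a → a ≤ b → b ≤ 1 → ∃ (K : NNReal) (k : ℝ≥0∞),
      LipschitzOnWith K γ (Icc a b) ∧ (∀ t ∈ Icc a b, ρ (γ t) ≤ k) ∧
      k * ENNReal.ofReal (K * (b - a)) ≤ ENNReal.ofReal (D * (b - a) * Real.exp (c * (b - a)))) :
    lineIntegral ρ γ ≤ ENNReal.ofReal D := by
  set V := variationOnFromTo γ (Icc 0 1) 0 with hV
  have key : ∀ n : ℕ, 0 < n → ∀ k : ℕ, k ≤ n →
      ∫⁻ s in Icc (V 0) (V (k / n)), ρ (naturalParameterization γ (Icc 0 1) 0 s)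
        ≤ k * ENNReal.ofReal (D * (1 / n) * Real.exp (c * (1 / n))) := by
    intro n hn k
    have hn' : (0 : ℝ) < n := Nat.cast_pos.2 hn
    induction k with
    | zero => intro _; simp
    | succ k ih =>
      intro hk
      have hab : (k / n : ℝ) ≤ ((k + 1 : ℕ) : ℝ) / n := by
        gcongr; exact k.le_succ
      have hb1 : ((k + 1 : ℕ) : ℝ) / n ≤ 1 := by
        rw [div_le_one hn']; exact_mod_cast hk
      obtain ⟨K, q, hK, hq, hKq⟩ := h (k / n) ((k + 1 : ℕ) / n) (by positivity) hab hb1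
      have h1 := (lintegral_Icc_variation_le hc hb (by positivity) hab hb1 hK hq).trans hKq
      have hsub : ((k + 1 : ℕ) : ℝ) / n - k / n = 1 / n := by push_cast; ring
      rw [hsub] at h1
      calc _ ≤ ∫⁻ s in Icc (V 0) (V (k / n)) ∪ Icc (V (k / n)) (V ((k + 1 : ℕ) / n)),
            ρ (naturalParameterization γ (Icc 0 1) 0 s) :=
            lintegral_mono_set Icc_subset_Icc_union_Icc
        _ ≤ _ := lintegral_union_le _ _ _
        _ ≤ k * ENNReal.ofReal (D * (1 / n) * Real.exp (c * (1 / n))) +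
            ENNReal.ofReal (D * (1 / n) * Real.exp (c * (1 / n))) :=
            add_le_add (ih (k.le_succ.trans hk)) h1
        _ = _ := by push_cast; ring
  have hlim : Tendsto (fun n : ℕ => ENNReal.ofReal (D * Real.exp (c * (1 / (n + 1 : ℕ))))) atTop
      (𝓝 (ENNReal.ofReal D)) := by
    refine ENNReal.tendsto_ofReal ?_
    have h1 : Tendsto (fun n : ℕ => (1 / (n + 1 : ℕ) : ℝ)) atTop (𝓝 0) := by
      simpa using tendsto_one_div_add_atTop_nhds_zero_nat (𝕜 := ℝ)
    have h2 := ((Real.continuous_exp.comp (continuous_const.mul continuous_id)).tendsto' (0 : ℝ) 1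
      (by simp : Real.exp (c * 0) = 1)).comp h1
    simpa using h2.const_mul D
  refine ge_of_tendsto' hlim fun n => ?_
  have h1 := key (n + 1) n.succ_pos (n + 1) le_rfl
  have hn : ((n + 1 : ℕ) : ℝ) ≠ 0 := Nat.cast_ne_zero.2 n.succ_ne_zero
  rw [div_self hn, hV, variationOnFromTo_one, variationOnFromTo.self] at h1
  refine h1.trans (le_of_eq ?_)
  rw [← ENNReal.ofReal_natCast, ← ENNReal.ofReal_mul (Nat.cast_nonneg _)]
  congr 1
  field_simp

end Subdivision

/-! ### Folding the space onto a half-plane. -/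

section Planar

variable {E : Type*} [NormedAddCommGroup E] [InnerProductSpace ℝ E]

/-- The coordinates of `z` in the half-plane bounded by the line through `0` and `x` that
contains `z`, scaled so that `x` corresponds to `1`. -/
noncomputable def planar (x z : E) : ℂ :=
  ⟨inner ℝ x z / ‖x‖ ^ 2, ‖z - (inner ℝ x z / ‖x‖ ^ 2) • x‖ / ‖x‖⟩

theorem planar_im_nonneg (x z : E) : 0 ≤ (planar x z).im :=
  div_nonneg (norm_nonneg _) (norm_nonneg _)

theorem inner_sub_projection {x : E} (hx : x ≠ 0) (z : E) :
    inner ℝ x (z - (inner ℝ x z / ‖x‖ ^ 2) • x) = 0 := by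
  have : ‖x‖ ≠ 0 := norm_ne_zero_iff.2 hx
  rw [inner_sub_right, inner_smul_right, real_inner_self_eq_norm_sq]
  field_simp
  ring

theorem norm_smul_add_smul {x e : E} (he : inner ℝ x e = 0) (hn : ‖e‖ = ‖x‖) (c : ℂ) :
    ‖c.re • x + c.im • e‖ = ‖x‖ * ‖c‖ := by
  refine (sq_eq_sq₀ (norm_nonneg _) (by positivity)).1 ?_
  rw [norm_add_sq_real, inner_smul_left, inner_smul_right, he, norm_smul, norm_smul, hn, mul_pow,
    mul_pow, mul_pow, Complex.sq_norm, Complex.normSq_apply, Real.norm_eq_abs, Real.norm_eq_abs,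
    sq_abs, sq_abs]
  ring

theorem planar_smul_add_smul {x e : E} (hx : x ≠ 0) (he : inner ℝ x e = 0) (hn : ‖e‖ = ‖x‖) {c : ℂ}
    (hc : 0 ≤ c.im) : planar x (c.re • x + c.im • e) = c := by
  have h0 : ‖x‖ ≠ 0 := norm_ne_zero_iff.2 hx
  have h1 : inner ℝ x (c.re • x + c.im • e) / ‖x‖ ^ 2 = c.re := by
    rw [inner_add_right, inner_smul_right, inner_smul_right, he, real_inner_self_eq_norm_sq]
    field_simp
    ring
  apply Complex.ext
  · exact h1
  · simp only [planar]
    rw [h1, add_sub_cancel_left, norm_smul, hn, Real.norm_eq_abs, abs_of_nonneg hc]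
    field_simp

/-- The vector `e` is the normalized component of `z` orthogonal to `x`. If `z` lies on the line
through `x`, any orthogonal direction serves; `hE` supplies one. -/
theorem exists_eq_planar_smul {x : E} (hx : x ≠ 0)
    (hE : ∃ e : E, inner ℝ x e = 0 ∧ ‖e‖ = ‖x‖) (z : E) :
    ∃ e : E, inner ℝ x e = 0 ∧ ‖e‖ = ‖x‖ ∧ z = (planar x z).re • x + (planar x z).im • e := by
  have h0 : ‖x‖ ≠ 0 := norm_ne_zero_iff.2 hx
  set w := z - (inner ℝ x z / ‖x‖ ^ 2) • x with hw
  by_cases h : w = 0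
  · obtain ⟨e, he, hn⟩ := hE
    refine ⟨e, he, hn, ?_⟩
    simp only [planar]
    rw [← hw, h, norm_zero, zero_div, zero_smul, add_zero]
    exact sub_eq_zero.1 h
  · have hw0 : ‖w‖ ≠ 0 := norm_ne_zero_iff.2 h
    refine ⟨(‖x‖ / ‖w‖) • w, ?_, ?_, ?_⟩
    · rw [inner_smul_right, inner_sub_projection hx, mul_zero]
    · rw [norm_smul, Real.norm_eq_abs, abs_of_nonneg (by positivity)]
      field_simp
    · simp only [planar]
      rw [← hw, smul_smul, show ‖w‖ / ‖x‖ * (‖x‖ / ‖w‖) = 1 by field_simp, one_smul, hw]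
      abel

theorem norm_planar {x : E} (hx : x ≠ 0) (z : E) : ‖planar x z‖ = ‖z‖ / ‖x‖ := by
  have h0 : ‖x‖ ≠ 0 := norm_ne_zero_iff.2 hx
  refine (sq_eq_sq₀ (norm_nonneg _) (by positivity)).1 ?_
  rw [Complex.sq_norm, Complex.normSq_apply, div_pow]
  simp only [planar]
  have h1 := norm_add_sq_real ((inner ℝ x z / ‖x‖ ^ 2) • x) (z - (inner ℝ x z / ‖x‖ ^ 2) • x)
  rw [add_sub_cancel, inner_smul_left, inner_sub_projection hx, norm_smul, mul_pow,
    Real.norm_eq_abs, sq_abs] at h1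
  rw [h1]
  simp only [mul_zero, add_zero]
  field_simp

theorem planar_ne_zero {x z : E} (hx : x ≠ 0) (hz : z ≠ 0) : planar x z ≠ 0 := by
  rw [← norm_ne_zero_iff, norm_planar hx]
  exact div_ne_zero (norm_ne_zero_iff.2 hz) (norm_ne_zero_iff.2 hx)

theorem planar_add_re {x : E} (z w : E) : (planar x (z + w)).re
    = (planar x z).re + (planar x w).re := by
  simp only [planar, inner_add_right, add_div]

theorem planar_smul_re {x : E} (t : ℝ) (z : E) :
    (planar x (t • z)).re = t * (planar x z).re := by
  simp only [planar, inner_smul_right, mul_div_assoc]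

/-- The imaginary part is a norm of an orthogonal component, hence subadditive. This inequality is
what transfers convexity from the plane to `E`. -/
theorem planar_add_im {x : E} (z w : E) : (planar x (z + w)).im
    ≤ (planar x z).im + (planar x w).im := by
  simp only [planar]
  rw [← add_div]
  gcongr
  refine le_of_eq_of_le ?_ (norm_add_le _ _)
  rw [inner_add_right, add_div, add_smul]
  congr 1
  abel

theorem planar_smul_im {x : E} (t : ℝ) (z : E) :
    (planar x (t • z)).im = |t| * (planar x z).im := by
  simp only [planar]
  rw [inner_smul_right, mul_div_assoc, mul_smul, ← smul_sub, norm_smul, Real.norm_eq_abs,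
    mul_div_assoc]

/-- Real parts subtract exactly, and the reverse triangle inequality controls the imaginary parts.
-/
theorem norm_planar_sub_le {x : E} (hx : x ≠ 0) (z w : E) :
    ‖planar x z - planar x w‖ ≤ ‖x‖⁻¹ * ‖z - w‖ := by
  have h1 : ‖planar x (z - w)‖ = ‖x‖⁻¹ * ‖z - w‖ := by rw [norm_planar hx]; ring
  rw [← h1]
  refine (sq_le_sq₀ (norm_nonneg _) (norm_nonneg _)).1 ?_
  rw [Complex.sq_norm, Complex.normSq_apply, Complex.sq_norm, Complex.normSq_apply,
    Complex.sub_re, Complex.sub_im]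
  have h2 : (planar x (z - w)).re = (planar x z).re - (planar x w).re := by
    have := planar_add_re (x := x) (z - w) w
    rw [sub_add_cancel] at this; linarith
  have h3 : |(planar x z).im - (planar x w).im| ≤ (planar x (z - w)).im := by
    have a := planar_add_im (x := x) (z - w) w
    have b := planar_add_im (x := x) (w - z) z
    have c : (planar x (w - z)).im = (planar x (z - w)).im := by
      have := planar_smul_im (x := x) (-1) (z - w)
      simpa using this
    rw [sub_add_cancel] at a b
    rw [abs_le]; constructor <;> linarith
  rw [h2]
  have h4 := mul_self_le_mul_self (abs_nonneg _) h3
  rw [abs_mul_abs_self] at h4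
  linarith

theorem planar_self {x : E} (hx : x ≠ 0) : planar x x = 1 := by
  have h0 : ‖x‖ ≠ 0 := norm_ne_zero_iff.2 hx
  have h1 : inner ℝ x x / ‖x‖ ^ 2 = 1 := by
    rw [real_inner_self_eq_norm_sq]; field_simp
  apply Complex.ext
  · simpa [planar] using h1
  · simp only [planar]
    rw [h1]; simp

/-- A ray from `x` stays in one half-plane, so the folding is affine along it. Questions about
starlikeness thereby become planar. -/
theorem planar_add_smul {x : E} (hx : x ≠ 0) (v : E) {t : ℝ} (ht : 0 ≤ t) :
    planar x (x + t • v) = 1 + t * planar x v := by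
  apply Complex.ext
  · rw [planar_add_re, planar_smul_re, planar_self hx]; simp
  · simp only [Complex.add_im, Complex.one_im, zero_add, Complex.im_ofReal_mul]
    rw [← abs_of_nonneg ht, ← planar_smul_im, abs_of_nonneg ht]
    have h0 : ‖x‖ ≠ 0 := norm_ne_zero_iff.2 hx
    simp only [planar]
    have h1 : inner ℝ x (x + t • v) / ‖x‖ ^ 2 = 1 + inner ℝ x (t • v) / ‖x‖ ^ 2 := by
      rw [inner_add_right, real_inner_self_eq_norm_sq]; field_simp
    rw [h1, add_smul, one_smul, add_sub_add_left_eq_sub]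

theorem lipschitzWith_planar {x : E} (hx : x ≠ 0) : LipschitzWith ‖x‖₊⁻¹ (planar x) :=
  LipschitzWith.of_dist_le_mul fun z w => by
    rw [dist_eq_norm, dist_eq_norm]; exact norm_planar_sub_le hx z w

theorem continuousAt_log_planar {x z : E} (hx : x ≠ 0) (hz : z ≠ 0) :
    ContinuousAt (fun w => Complex.log (planar x w)) z :=
  (Complex.continuousWithinAt_log_im_nonneg (planar_ne_zero hx hz)
    (planar_im_nonneg x z)).tendsto.comp
    (tendsto_nhdsWithin_iff.2 ⟨(lipschitzWith_planar hx).continuous.continuousAt,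
      Eventually.of_forall fun w => planar_im_nonneg x w⟩)

end Planar

/-! ### The quasihyperbolic distance in closed form. -/

section QuasihyperbolicDistance

variable {E : Type*} [NormedAddCommGroup E] [InnerProductSpace ℝ E]

theorem infEDist_frontier_compl_zero {x : E} (hx : x ≠ 0) (z : E) :
    Metric.infEDist z (frontier ({0}ᶜ : Set E)) = ‖z‖ₑ := by
  have : Nontrivial E := ⟨x, 0, hx⟩
  have : (𝓝[≠] (0 : E)).NeBot := Module.punctured_nhds_neBot ℝ E 0
  rw [frontier_compl, frontier, closure_singleton, interior_singleton, sdiff_empty,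
    Metric.infEDist_singleton, edist_zero_right]

theorem lineIntegral_inv_infEDist {x : E} (hx : x ≠ 0) (γ : ℝ → E) :
    lineIntegral (fun z => (Metric.infEDist z (frontier ({0}ᶜ : Set E)))⁻¹) γ
      = lineIntegral (fun z => ‖z‖ₑ⁻¹) γ := by
  simp only [infEDist_frontier_compl_zero hx]

theorem le_lineIntegral {x y : E} (hx : x ≠ 0) {γ : ℝ → E}
    (hγ : γ ∈ rectifiableCurves ({0}ᶜ : Set E) x y) :
    ENNReal.ofReal ‖Complex.log (planar x y)‖ ≤ lineIntegral (fun z => ‖z‖ₑ⁻¹) γ := by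
  obtain ⟨hc, hb, hG, h0, h1⟩ := hγ
  have hℓ : 0 ≤ curveLength γ := ENNReal.toReal_nonneg
  set ℓ := curveLength γ with hℓdef
  set g := naturalParameterization γ (Icc 0 1) 0 with hg
  have hV0 : variationOnFromTo γ (Icc 0 1) 0 0 = 0 := variationOnFromTo.self _ _ _
  have m0 : (0 : ℝ) ∈ Icc (0 : ℝ) 1 := ⟨le_rfl, zero_le_one⟩
  have m1 : (1 : ℝ) ∈ Icc (0 : ℝ) 1 := ⟨zero_le_one, le_rfl⟩
  have g0 : g 0 = x := by
    have h := naturalParameterization_variationOnFromTo hb.locallyBoundedVariationOn m0 m0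
    rwa [hV0, h0] at h
  have g1 : g ℓ = y := by
    rw [hg, hℓdef, ← variationOnFromTo_one,
      naturalParameterization_variationOnFromTo hb.locallyBoundedVariationOn m0 m1, h1]
  -- Extending the arc length parametrization by constants makes it Lipschitz and nonzero on all of
  -- `ℝ`.
  set q : ℝ → E := fun s => g (projIcc 0 ℓ hℓ s) with hq
  have hqL : LipschitzWith 1 q := by
    refine LipschitzWith.of_dist_le_mul fun s t => ?_
    have h2 := (lipschitzOnWith_naturalParameterization hc hb).dist_le_mul
      (projIcc 0 ℓ hℓ s) (projIcc 0 ℓ hℓ s).2 (projIcc 0 ℓ hℓ t) (projIcc 0 ℓ hℓ t).2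
    have h3 := (LipschitzWith.projIcc hℓ).dist_le_mul s t
    rw [NNReal.coe_one, one_mul] at *
    exact h2.trans h3
  have hq0 : ∀ s, q s ≠ 0 := fun s => by
    obtain ⟨t, ht, -, h⟩ := exists_naturalParameterization_eq hc hb (projIcc 0 ℓ hℓ s).2
    rw [hq]
    simp only
    rw [hg, h]
    exact hG ht
  have hqe : ∀ s ∈ Icc 0 ℓ, q s = g s := fun s hs => by
    simp only [hq, projIcc_of_mem hℓ hs]
  have hx0 : 0 < ‖x‖ := norm_pos_iff.2 hx
  have key := Complex.norm_log_sub_norm_log_le_integral (c := fun s => planar x (q s))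
    (K := ‖x‖₊⁻¹ * 1) ((lipschitzWith_planar hx).comp hqL)
    (fun s => planar_ne_zero hx (hq0 s)) (fun s => planar_im_nonneg x _) hℓ
  simp only [hqe 0 ⟨le_rfl, hℓ⟩, hqe ℓ ⟨hℓ, le_rfl⟩, g0, g1, planar_self hx, Complex.log_one,
    norm_zero, sub_zero, norm_planar hx, mul_one, NNReal.coe_inv, coe_nnnorm] at key
  have hcont : Continuous fun s => ‖q s‖⁻¹ :=
    hqL.continuous.norm.inv₀ fun s => norm_ne_zero_iff.2 (hq0 s)
  have e1 : (fun s => ‖x‖⁻¹ / (‖q s‖ / ‖x‖)) = fun s => ‖q s‖⁻¹ := by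
    funext s; field_simp
  rw [e1, intervalIntegral.integral_of_le hℓ, ← integral_Icc_eq_integral_Ioc] at key
  refine (ENNReal.ofReal_le_ofReal key).trans (le_of_eq ?_)
  rw [ofReal_integral_eq_lintegral_ofReal (hcont.integrableOn_Icc)
    (Eventually.of_forall fun s => inv_nonneg.2 (norm_nonneg _)), lineIntegral]
  refine setLIntegral_congr_fun measurableSet_Icc fun s hs => ?_
  rw [ENNReal.ofReal_inv_of_pos (norm_pos_iff.2 (hq0 s)), ofReal_norm, hqe s hs]

theorem norm_cexp_mul_sub_le {ζ : ℂ} {a b s t : ℝ} (hs : s ∈ Icc a b) (ht : t ∈ Icc a b) :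
    ‖Complex.exp (s * ζ) - Complex.exp (t * ζ)‖
      ≤ ‖ζ‖ * Real.exp (a * ζ.re + |ζ.re| * (b - a)) * ‖s - t‖ := by
  refine Convex.norm_image_sub_le_of_norm_hasDerivWithin_le
    (f := fun r : ℝ => Complex.exp (r * ζ)) (f' := fun r : ℝ => Complex.exp (r * ζ) * ζ)
    (s := Icc a b) (fun r _ => ?_) (fun r hr => ?_) (convex_Icc a b) ht hs
  · have h1 : HasDerivAt (fun r : ℝ => (r : ℂ) * ζ) ζ r := by
      simpa using (Complex.ofRealCLM.hasDerivAt (x := r)).mul_const ζ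
    exact h1.cexp.hasDerivWithinAt
  · rw [norm_mul, mul_comm, Complex.norm_exp, Complex.re_ofReal_mul]
    gcongr
    have h2 := mul_le_mul_of_nonneg_right (le_abs_self ζ.re) (sub_nonneg.2 hr.1)
    have h3 := mul_le_mul_of_nonneg_left (sub_le_sub_right hr.2 a) (abs_nonneg ζ.re)
    linarith

/-- The curve is the logarithmic spiral `exp (t ζ)`, the preimage of the segment from `0` to `ζ` in
logarithmic coordinates; speed divided by distance from the origin is constantly `‖ζ‖`. -/
theorem exists_lineIntegral_le {x y : E} (hx : x ≠ 0) (hy : y ≠ 0)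
    (hE : ∃ e : E, inner ℝ x e = 0 ∧ ‖e‖ = ‖x‖) :
    ∃ γ ∈ rectifiableCurves ({0}ᶜ : Set E) x y,
      lineIntegral (fun z => ‖z‖ₑ⁻¹) γ ≤ ENNReal.ofReal ‖Complex.log (planar x y)‖ := by
  obtain ⟨e, he, hn, hye⟩ := exists_eq_planar_smul hx hE y
  set ζ := Complex.log (planar x y) with hζ
  have hx0 : 0 < ‖x‖ := norm_pos_iff.2 hx
  set γ : ℝ → E := fun t =>
    (Complex.exp (t * ζ)).re • x + (Complex.exp (t * ζ)).im • e with hγ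
  have hnorm : ∀ t, ‖γ t‖ = ‖x‖ * Real.exp (t * ζ.re) := fun t => by
    rw [hγ]
    simp only
    rw [norm_smul_add_smul he hn, Complex.norm_exp, Complex.re_ofReal_mul]
  have hsub : ∀ s t, ‖γ s - γ t‖ = ‖x‖ * ‖Complex.exp (s * ζ) - Complex.exp (t * ζ)‖ :=
    fun s t => by
      rw [← norm_smul_add_smul he hn, Complex.sub_re, Complex.sub_im, sub_smul, sub_smul]
      congr 1
      simp only [hγ]
      abel
  have hLip : ∀ a b : ℝ, LipschitzOnWith
      (Real.toNNReal (‖x‖ * (‖ζ‖ * Real.exp (a * ζ.re + |ζ.re| * (b - a))))) γ (Icc a b) := by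
    intro a b
    refine LipschitzOnWith.of_dist_le_mul fun s hs t ht => ?_
    rw [dist_eq_norm, dist_eq_norm, hsub, Real.coe_toNNReal _ (by positivity), mul_assoc]
    exact mul_le_mul_of_nonneg_left (norm_cexp_mul_sub_le hs ht) hx0.le
  have hcont : ContinuousOn γ (Icc 0 1) := (hLip 0 1).continuousOn
  have hbv : BoundedVariationOn γ (Icc 0 1) := by
    have := (hLip 0 1).locallyBoundedVariationOn 0 1 ⟨le_rfl, zero_le_one⟩ ⟨zero_le_one, le_rfl⟩
    rwa [inter_self] at this
  refine ⟨γ, ⟨hcont, hbv, fun t _ => ?_, ?_, ?_⟩, ?_⟩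
  · rw [mem_compl_singleton_iff, ← norm_ne_zero_iff, hnorm]
    positivity
  · simp [hγ]
  · simp only [hγ]
    rw [Complex.ofReal_one, one_mul, hζ, Complex.exp_log (planar_ne_zero hx hy), ← hye]
  -- On `[a, b]` the bounds for the speed and for the density each lose a factor `exp (|ζ.re| (b -
  -- a))`, whence the `2`.
  · refine lineIntegral_le_of_forall_Icc (c := 2 * |ζ.re|) hcont hbv fun a b _ hab _ => ?_
    refine ⟨_, ENNReal.ofReal (‖x‖⁻¹ * Real.exp (-(a * ζ.re) + |ζ.re| * (b - a))), hLip a b,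
      fun t ht => ?_, ?_⟩
    · have hpos : 0 < ‖γ t‖ := by rw [hnorm]; positivity
      rw [← ofReal_norm, ← ENNReal.ofReal_inv_of_pos hpos, hnorm, mul_inv, ← Real.exp_neg]
      refine ENNReal.ofReal_le_ofReal ?_
      gcongr
      have h2 := mul_le_mul_of_nonneg_right (neg_abs_le ζ.re) (sub_nonneg.2 ht.1)
      have h3 := mul_le_mul_of_nonneg_left (sub_le_sub_right ht.2 a) (abs_nonneg ζ.re)
      linarith
    · rw [Real.coe_toNNReal _ (by positivity), ← ENNReal.ofReal_mul (by positivity)]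
      refine ENNReal.ofReal_le_ofReal (le_of_eq ?_)
      rw [show 2 * |ζ.re| * (b - a) = (-(a * ζ.re) + |ζ.re| * (b - a)) +
        (a * ζ.re + |ζ.re| * (b - a)) by ring,
        Real.exp_add (-(a * ζ.re) + |ζ.re| * (b - a))]
      generalize Real.exp (-(a * ζ.re) + |ζ.re| * (b - a)) = p
      generalize Real.exp (a * ζ.re + |ζ.re| * (b - a)) = q
      field_simp

theorem quasihyperbolicDist_compl_zero {x y : E} (hx : x ≠ 0) (hy : y ≠ 0)
    (hE : ∃ e : E, inner ℝ x e = 0 ∧ ‖e‖ = ‖x‖) :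
    quasihyperbolicDist ({0}ᶜ : Set E) x y = ENNReal.ofReal ‖Complex.log (planar x y)‖ := by
  simp only [quasihyperbolicDist, lineIntegral_inv_infEDist hx]
  refine le_antisymm ?_ (le_iInf₂ fun γ hγ => le_lineIntegral hx hγ)
  obtain ⟨γ, hγ, h⟩ := exists_lineIntegral_le hx hy hE
  exact (iInf₂_le γ hγ).trans h

theorem mem_quasihyperbolicBall_compl_zero {x z : E} (hx : x ≠ 0)
    (hE : ∃ e : E, inner ℝ x e = 0 ∧ ‖e‖ = ‖x‖) {M : ℝ} :
    z ∈ quasihyperbolicBall ({0}ᶜ : Set E) x M ↔ z ≠ 0 ∧ ‖Complex.log (planar x z)‖ < M := by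
  simp only [quasihyperbolicBall, mem_ofPred_eq, mem_compl_singleton_iff]
  refine and_congr_right fun hz => ?_
  rw [quasihyperbolicDist_compl_zero hx hz hE, ENNReal.ofReal_lt_ofReal_iff']
  exact ⟨fun h => h.1, fun h => ⟨h, (norm_nonneg _).trans_lt h⟩⟩

end QuasihyperbolicDistance

/-! ### Sharp Taylor estimates for `exp` and the supporting tangent line. -/

section ExpInequality

/-- Follows from `(1 - b + b²/2) (1 + b + b²/2) = 1 + b⁴/4 > 1`. -/
theorem Real.exp_neg_lt_one_sub_add_sq {b : ℝ} (hb : 0 < b) :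
    Real.exp (-b) < 1 - b + b ^ 2 / 2 := by
  have h1 := Real.quadratic_le_exp_of_nonneg hb.le
  have h2 : Real.exp (-b) * Real.exp b = 1 := by rw [← Real.exp_add]; simp
  have h3 : 0 < Real.exp (-b) := Real.exp_pos _
  have h4 : 0 < b ^ 4 := by positivity
  have h5 : Real.exp (-b) * (1 + b + b ^ 2 / 2) ≤ 1 :=
    (mul_le_mul_of_nonneg_left h1 h3.le).trans h2.le
  have h6 : 0 < 1 + b + b ^ 2 / 2 := by positivity
  refine lt_of_mul_lt_mul_right (h5.trans_lt ?_) h6.le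
  nlinarith

/-- This is the strict bound `|exp (ib) - 1 - ib| < b²/2`. With `b = 2s`, the left side is at most
`4 (s - sin s)² + 4 s³ sin s`, and `(s - sin s)² < s³ (s - sin s)`. -/
theorem Real.one_sub_cos_sq_add_sub_sin_sq_lt {b : ℝ} (hb : b ≠ 0) (hb2 : |b| ≤ 2) :
    (1 - Real.cos b) ^ 2 + (b - Real.sin b) ^ 2 < (b ^ 2 / 2) ^ 2 := by
  wlog hpos : 0 < b generalizing b
  · have := this (b := -b) (neg_ne_zero.2 hb) (by rwa [abs_neg])
      (neg_pos.2 (lt_of_le_of_ne (not_lt.1 hpos) hb))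
    rw [Real.cos_neg, Real.sin_neg] at this
    nlinarith
  obtain ⟨s, rfl⟩ : ∃ s, b = 2 * s := ⟨b / 2, by ring⟩
  have hs : 0 < s := by linarith
  have hs1 : s ≤ 1 := by rw [abs_of_pos hpos] at hb2; linarith
  have h1 := Real.sin_gt_sub_cube hs
  have h2 := Real.sin_lt hs
  have h3 := Real.one_sub_sq_div_two_le_cos (x := s)
  have h4 : 0 < Real.sin s := Real.sin_pos_of_pos_of_lt_pi hs (by linarith [Real.pi_gt_three])
  have h5 := Real.sin_sq_add_cos_sq s
  have h6 : s * Real.sin s * (1 - s ^ 2 / 2) ≤ s * Real.sin s * Real.cos s :=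
    mul_le_mul_of_nonneg_left h3 (by positivity)
  have h7 : (s - Real.sin s) * (s - Real.sin s - s ^ 3) < 0 :=
    mul_neg_of_pos_of_neg (by linarith) (by linarith [pow_pos hs 3])
  have h8 := Real.sin_sq_add_cos_sq (2 * s)
  have h9 : (1 - Real.cos (2 * s)) ^ 2 + (2 * s - Real.sin (2 * s)) ^ 2
      = 2 - 2 * Real.cos (2 * s) + 4 * s ^ 2 - 4 * s * Real.sin (2 * s) := by nlinarith
  rw [h9, Real.cos_two_mul, Real.sin_two_mul]
  have h10 : Real.cos s ^ 2 = 1 - Real.sin s ^ 2 := by linarith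
  rw [h10]
  nlinarith

/-- Integrating `‖exp (t η)‖ = exp (t a)` twice bounds the remainder by `‖η‖² (exp a - 1 - a) / a²`,
and the real factor is below `1/2` for `a < 0`. -/
theorem Complex.norm_exp_sub_one_sub_id_lt {η : ℂ} (h : η.re < 0) :
    ‖Complex.exp η - 1 - η‖ < ‖η‖ ^ 2 / 2 := by
  set a := η.re with ha
  have hlin : ∀ t : ℝ, HasDerivAt (fun r : ℝ => (r : ℂ) * η) η t := fun t => by
    simpa using (Complex.ofRealCLM.hasDerivAt (x := t)).mul_const η
  have hexp : ∀ t : ℝ, HasDerivAt (fun r : ℝ => Complex.exp (r * η)) (Complex.exp (t * η) * η) t :=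
    fun t => (hlin t).cexp
  have hrlin : ∀ t : ℝ, HasDerivAt (fun r : ℝ => r * a) a t := fun t => by
    simpa using (hasDerivAt_id t).mul_const a
  have hrexp : ∀ t : ℝ, HasDerivAt (fun r : ℝ => Real.exp (r * a)) (Real.exp (t * a) * a) t :=
    fun t => (hrlin t).exp
  have h1 : ∀ t ∈ Icc (0 : ℝ) 1,
      ‖Complex.exp (t * η) - 1‖ ≤ ‖η‖ * ((Real.exp (t * a) - 1) / a) := by
    intro t ht
    refine image_norm_le_of_norm_deriv_right_le_deriv_boundary (a := 0) (b := 1)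
      (f := fun t : ℝ => Complex.exp (t * η) - 1) (f' := fun t : ℝ => Complex.exp (t * η) * η)
      (B := fun t => ‖η‖ * ((Real.exp (t * a) - 1) / a))
      (B' := fun t => ‖η‖ * (Real.exp (t * a) * a / a))
      (fun t _ => ((hexp t).sub_const 1).continuousAt.continuousWithinAt)
      (fun t _ => ((hexp t).sub_const 1).hasDerivWithinAt) (by simp)
      (fun t => (((hrexp t).sub_const 1).div_const a).const_mul ‖η‖) (fun t _ => ?_) ht
    rw [norm_mul, Complex.norm_exp, Complex.re_ofReal_mul, mul_div_cancel_right₀ _ h.ne, mul_comm]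
  have h2 : ‖Complex.exp ((1 : ℝ) * η) - 1 - (1 : ℝ) * η‖
      ≤ ‖η‖ ^ 2 * ((Real.exp (1 * a) - 1 - 1 * a) / a ^ 2) := by
    refine image_norm_le_of_norm_deriv_right_le_deriv_boundary (a := 0) (b := 1)
      (f := fun t : ℝ => Complex.exp (t * η) - 1 - t * η)
      (f' := fun t : ℝ => Complex.exp (t * η) * η - η)
      (B := fun t => ‖η‖ ^ 2 * ((Real.exp (t * a) - 1 - t * a) / a ^ 2))
      (B' := fun t => ‖η‖ ^ 2 * ((Real.exp (t * a) * a - a) / a ^ 2))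
      (fun t _ => (((hexp t).sub_const 1).sub (hlin t)).continuousAt.continuousWithinAt)
      (fun t _ => (((hexp t).sub_const 1).sub (hlin t)).hasDerivWithinAt) (by simp)
      (fun t => ((((hrexp t).sub_const 1).sub (hrlin t)).div_const (a ^ 2)).const_mul (‖η‖ ^ 2))
      (fun t ht => ?_) ⟨zero_le_one, le_rfl⟩
    have h3 := h1 t ⟨ht.1, ht.2.le⟩
    have h4 : Complex.exp (t * η) * η - η = (Complex.exp (t * η) - 1) * η := by ring
    rw [h4, norm_mul]
    refine (mul_le_mul_of_nonneg_right h3 (norm_nonneg _)).trans (le_of_eq ?_)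
    field_simp [h.ne]
  rw [Complex.ofReal_one, one_mul, one_mul] at h2
  refine h2.trans_lt ?_
  have h5 := Real.exp_neg_lt_one_sub_add_sq (neg_pos.2 h)
  rw [neg_neg] at h5
  have h6 : 0 < ‖η‖ := norm_pos_iff.2 fun h0 => by simp [ha, h0] at h
  have h7 : (Real.exp a - 1 - a) / a ^ 2 < 1 / 2 := by
    rw [div_lt_iff₀ (by have := h.ne; positivity)]; linarith
  calc ‖η‖ ^ 2 * ((Real.exp a - 1 - a) / a ^ 2) < ‖η‖ ^ 2 * (1 / 2) :=
        mul_lt_mul_of_pos_left h7 (by positivity)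
    _ = ‖η‖ ^ 2 / 2 := by ring

theorem neg_mul_sub_mul_lt_of_sq_add_sq_lt {p q X Y Q : ℝ} (h : p ^ 2 + q ^ 2 ≤ 1) (hQ : 0 ≤ Q)
    (hXY : X ^ 2 + Y ^ 2 < Q ^ 2) : -(p * X + q * Y) < Q := by
  refine (neg_le_abs _).trans_lt (abs_lt_of_sq_lt_sq ?_ hQ)
  nlinarith [sq_nonneg (p * Y - q * X), sq_nonneg X, sq_nonneg Y]

/-- For a fixed point `(p, q)` of the closed unit disc, the function `Re (exp z)` multiplied by the
appropriate constant attains its maximum over the disc of radius `‖(p, q)‖` only at `(p, q)`. -/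
theorem Real.exp_mul_cos_add_sin_lt {p q a b : ℝ} (h1 : p ^ 2 + q ^ 2 ≤ 1)
    (h : (p + a) ^ 2 + (q + b) ^ 2 ≤ p ^ 2 + q ^ 2) (hne : a ≠ 0 ∨ b ≠ 0) :
    Real.exp a * (p * Real.cos b + q * Real.sin b) < p := by
  -- With `η = a + ib`, the claim is that `Re ((p - iq) (exp η - 1))` is negative. The linear term
  -- is at most `-‖η‖²/2`, so a remainder smaller than `‖η‖²/2` suffices.
  have hlin : p * a + q * b ≤ -((a ^ 2 + b ^ 2) / 2) := by nlinarith
  have hQ : 0 ≤ (a ^ 2 + b ^ 2) / 2 := by positivity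
  rcases lt_or_ge a 0 with ha | ha
  · have h2 := Complex.norm_exp_sub_one_sub_id_lt (η := ⟨a, b⟩) ha
    have h3 := pow_lt_pow_left₀ h2 (norm_nonneg _) two_ne_zero
    rw [Complex.sq_norm, Complex.sq_norm, Complex.normSq_apply, Complex.normSq_apply] at h3
    simp only [Complex.sub_re, Complex.sub_im, Complex.exp_re, Complex.exp_im, Complex.one_re,
      Complex.one_im] at h3
    have h4 := neg_mul_sub_mul_lt_of_sq_add_sq_lt (X := 1 + a - Real.exp a * Real.cos b)
      (Y := b - Real.exp a * Real.sin b) h1 hQ (by nlinarith)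
    nlinarith
  -- For `a ≥ 0` the remainder of `exp η` may be too large. After multiplication by `exp (-a)`, the
  -- remainder splits into those of `exp (ib)` and `exp (-a)`, both controlled; `|b| ≤ 2` because
  -- both points lie in the unit disc.
  · have hb2 : |b| ≤ 2 := by
      refine abs_le_of_sq_le_sq ?_ zero_le_two
      nlinarith [sq_nonneg a, sq_nonneg (a + 2 * p), sq_nonneg (b + 2 * q), sq_nonneg (b + q),
        sq_nonneg (q - b)]
    have hc1 := Real.one_sub_sq_div_two_le_cos (x := b)
    have hc2 := Real.cos_le_one b
    have hP0 : 0 ≤ Real.exp (-a) - 1 + a := by linarith [Real.add_one_le_exp (-a)]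
    have hX : ((1 - Real.cos b) + (Real.exp (-a) - 1 + a)) ^ 2 + (b - Real.sin b) ^ 2
        < ((a ^ 2 + b ^ 2) / 2) ^ 2 := by
      rcases ha.eq_or_lt with rfl | ha
      · have hb : b ≠ 0 := by simpa using hne
        have := Real.one_sub_cos_sq_add_sub_sin_sq_lt hb hb2
        simpa using this
      · have hP := Real.exp_neg_lt_one_sub_add_sq ha
        have hB : (1 - Real.cos b) ^ 2 + (b - Real.sin b) ^ 2 ≤ (b ^ 2 / 2) ^ 2 := by
          rcases eq_or_ne b 0 with rfl | hb
          · simp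
          · exact (Real.one_sub_cos_sq_add_sub_sin_sq_lt hb hb2).le
        set P := Real.exp (-a) - 1 + a
        have hP' : P < a ^ 2 / 2 := by simp only [P]; linarith
        have e1 : P ^ 2 < (a ^ 2 / 2) ^ 2 := pow_lt_pow_left₀ hP' hP0 two_ne_zero
        have e2 : (1 - Real.cos b) * P ≤ (b ^ 2 / 2) * (a ^ 2 / 2) :=
          mul_le_mul (by linarith) hP'.le hP0 (by positivity)
        nlinarith
    have h4 := neg_mul_sub_mul_lt_of_sq_add_sq_lt h1 hQ hX
    have h5 : Real.exp a * Real.exp (-a) = 1 := by rw [← Real.exp_add]; simp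
    have h6 : p * Real.cos b + q * Real.sin b < p * Real.exp (-a) := by nlinarith
    calc _ < Real.exp a * (p * Real.exp (-a)) := mul_lt_mul_of_pos_left h6 (Real.exp_pos a)
      _ = p := by rw [mul_left_comm, h5, mul_one]

theorem Complex.sq_norm_log (z : ℂ) : ‖Complex.log z‖ ^ 2 = Real.log ‖z‖ ^ 2 + z.arg ^ 2 := by
  rw [Complex.sq_norm, Complex.normSq_apply, Complex.log_re, Complex.log_im]; ring

/-- The disc `‖log z‖ ≤ ‖log w‖ ≤ 1` lies on one side of the tangent line to its boundary at `w`. -/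
theorem Complex.tangent_lt {z w : ℂ} (hz : z ≠ 0) (hw : w ≠ 0) (hw1 : ‖Complex.log w‖ ≤ 1)
    (hzw : ‖Complex.log z‖ ≤ ‖Complex.log w‖) (hne : z ≠ w) :
    (Real.log ‖w‖ * Real.cos w.arg - w.arg * Real.sin w.arg) * (z.re - w.re) +
      (Real.log ‖w‖ * Real.sin w.arg + w.arg * Real.cos w.arg) * (z.im - w.im) < 0 := by
  have hz0 : 0 < ‖z‖ := norm_pos_iff.2 hz
  have hw0 : 0 < ‖w‖ := norm_pos_iff.2 hw
  have h1 : Real.log ‖w‖ ^ 2 + w.arg ^ 2 ≤ 1 := by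
    rw [← Complex.sq_norm_log]
    exact pow_le_one₀ (norm_nonneg _) hw1
  have h2 : (Real.log ‖w‖ + (Real.log ‖z‖ - Real.log ‖w‖)) ^ 2 + (w.arg + (z.arg - w.arg)) ^ 2
      ≤ Real.log ‖w‖ ^ 2 + w.arg ^ 2 := by
    rw [add_sub_cancel, add_sub_cancel, ← Complex.sq_norm_log, ← Complex.sq_norm_log]
    exact pow_le_pow_left₀ (norm_nonneg _) hzw 2
  have h3 : Real.log ‖z‖ - Real.log ‖w‖ ≠ 0 ∨ z.arg - w.arg ≠ 0 := by
    by_contra! h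
    refine hne (Complex.ext_norm_arg ?_ (sub_eq_zero.1 h.2))
    exact Real.log_injOn_pos hz0 hw0 (sub_eq_zero.1 h.1)
  have h4 := Real.exp_mul_cos_add_sin_lt h1 h2 h3
  rw [Real.exp_sub, Real.exp_log hz0, Real.exp_log hw0, Real.cos_sub, Real.sin_sub,
    div_mul_eq_mul_div, div_lt_iff₀ hw0] at h4
  rw [← Complex.norm_mul_cos_arg z, ← Complex.norm_mul_cos_arg w, ← Complex.norm_mul_sin_arg z,
    ← Complex.norm_mul_sin_arg w]
  have h5 := Real.sin_sq_add_cos_sq w.arg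
  have h6 : ‖w‖ * Real.log ‖w‖ * (Real.sin w.arg ^ 2 + Real.cos w.arg ^ 2)
    = ‖w‖ * Real.log ‖w‖ := by rw [h5, mul_one]
  linarith

/-- This is the imaginary component of the normal in `Complex.tangent_lt`. Its sign is needed
because the imaginary part of `planar` is only convex, not affine. -/
theorem Real.mul_sin_add_mul_cos_nonneg {p q : ℝ} (h : p ^ 2 + q ^ 2 ≤ 1) (hq : 0 ≤ q) :
    0 ≤ p * Real.sin q + q * Real.cos q := by
  have hq1 : q ≤ 1 := by nlinarith
  have hs : 0 ≤ Real.sin q :=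
    Real.sin_nonneg_of_nonneg_of_le_pi hq (by linarith [Real.pi_gt_three])
  have hc : 0 ≤ Real.cos q := Real.cos_nonneg_of_neg_pi_div_two_le_of_le
    (by linarith [Real.pi_gt_three]) (by linarith [Real.pi_gt_three])
  have hsq : Real.sin q ≤ q := Real.sin_le hq
  have h1 := Real.sin_sq_add_cos_sq q
  have h2 : |p * Real.sin q| ≤ q * Real.cos q := by
    refine abs_le_of_sq_le_sq ?_ (by positivity)
    have h3 : Real.sin q ^ 2 ≤ q ^ 2 := pow_le_pow_left₀ hs hsq 2
    have h4 : p ^ 2 * Real.sin q ^ 2 ≤ (1 - q ^ 2) * Real.sin q ^ 2 :=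
      mul_le_mul_of_nonneg_right (by linarith) (sq_nonneg _)
    have h5 : Real.cos q ^ 2 = 1 - Real.sin q ^ 2 := by linarith
    rw [mul_pow, mul_pow, h5]
    nlinarith
  linarith [neg_abs_le (p * Real.sin q)]

end ExpInequality

/-! ### The logarithmic ball and its convexity. -/

section Ball

variable {E : Type*} [NormedAddCommGroup E] [InnerProductSpace ℝ E]

/-- The ball of radius `M` with centre `x` in the logarithmic coordinates of the half-planes
bounded by the line through `0` and `x`. -/
def logBall (x : E) (M : ℝ) : Set E :=
  {z | z ≠ 0 ∧ ‖Complex.log (planar x z)‖ < M}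

theorem norm_log_planar_self {x : E} (hx : x ≠ 0) : ‖Complex.log (planar x x)‖ = 0 := by
  rw [planar_self hx, Complex.log_one, norm_zero]

theorem self_mem_logBall {x : E} (hx : x ≠ 0) {M : ℝ} (hM : 0 < M) : x ∈ logBall x M :=
  ⟨hx, by rwa [norm_log_planar_self hx]⟩

theorem isOpen_logBall {x : E} (hx : x ≠ 0) (M : ℝ) : IsOpen (logBall x M) := by
  refine isOpen_iff_mem_nhds.2 fun z hz => ?_
  filter_upwards [isOpen_ne.mem_nhds hz.1,
    (continuousAt_log_planar hx hz.1).norm.eventually (gt_mem_nhds hz.2)] with w h1 h2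
  exact ⟨h1, h2⟩

theorem abs_log_norm_le {x : E} (hx : x ≠ 0) (z : E) :
    |Real.log (‖z‖ / ‖x‖)| ≤ ‖Complex.log (planar x z)‖ := by
  rw [← norm_planar hx, ← Complex.log_re]
  exact Complex.abs_re_le_norm _

theorem norm_ge_of_mem_logBall {x z : E} (hx : x ≠ 0) {M : ℝ} (hz : z ∈ logBall x M) :
    ‖x‖ * Real.exp (-M) ≤ ‖z‖ := by
  have h1 := (abs_log_norm_le hx z).trans hz.2.le
  have hx0 := norm_pos_iff.2 hx
  have hz0 := norm_pos_iff.2 hz.1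
  have h2 := Real.exp_le_exp.2 (abs_le.1 h1).1
  rwa [Real.exp_log (by positivity), le_div_iff₀ hx0, mul_comm] at h2

theorem norm_le_of_mem_logBall {x z : E} (hx : x ≠ 0) {M : ℝ} (hz : z ∈ logBall x M) :
    ‖z‖ ≤ ‖x‖ * Real.exp M := by
  have h1 := (abs_log_norm_le hx z).trans hz.2.le
  have hx0 := norm_pos_iff.2 hx
  have hz0 := norm_pos_iff.2 hz.1
  have h2 := Real.exp_le_exp.2 (abs_le.1 h1).2
  rwa [Real.exp_log (by positivity), div_le_iff₀ hx0, mul_comm] at h2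

theorem isBounded_logBall {x : E} (hx : x ≠ 0) (M : ℝ) : Bornology.IsBounded (logBall x M) :=
  isBounded_iff_forall_norm_le.2 ⟨_, fun _ hz => norm_le_of_mem_logBall hx hz⟩

theorem mem_closure_logBall {x z : E} (hx : x ≠ 0) {M : ℝ} (hz : z ∈ closure (logBall x M)) :
    z ≠ 0 ∧ ‖Complex.log (planar x z)‖ ≤ M := by
  have hsub : closure (logBall x M) ⊆ {w | ‖x‖ * Real.exp (-M) ≤ ‖w‖} :=
    closure_minimal (fun w hw => norm_ge_of_mem_logBall hx hw)
      (isClosed_le continuous_const continuous_norm)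
  have hx0 := norm_pos_iff.2 hx
  have h0 : z ≠ 0 := norm_pos_iff.1 (lt_of_lt_of_le (by positivity) (hsub hz))
  refine ⟨h0, ?_⟩
  obtain ⟨u, hu, hlim⟩ := mem_closure_iff_seq_limit.1 hz
  exact le_of_tendsto' ((continuousAt_log_planar hx h0).norm.tendsto.comp hlim)
    fun n => (hu n).2.le

theorem mem_frontier_logBall {x z : E} (hx : x ≠ 0) {M : ℝ} (hz : z ∈ frontier (logBall x M)) :
    z ∈ closure (logBall x M) ∧ ‖Complex.log (planar x z)‖ = M := by
  rw [(isOpen_logBall hx M).frontier_eq] at hz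
  obtain ⟨h0, h1⟩ := mem_closure_logBall hx hz.1
  exact ⟨hz.1, le_antisymm h1 (not_lt.1 fun h => hz.2 ⟨h0, h⟩)⟩

/-- The tangent functional at `w` does not exceed its value at `w` at either end point, while
convexity bounds that value by the weighted mean of the other two. Equality makes all three planar
images coincide, so the norms agree, against strict convexity of the norm. -/
theorem openSegment_norm_log_lt {x y z w : E} (hx : x ≠ 0) (hy0 : y ≠ 0) (hz0 : z ≠ 0)
    (hw0 : w ≠ 0) (hyz : y ≠ z) (hw : w ∈ openSegment ℝ y z)
    (h1 : ‖Complex.log (planar x w)‖ ≤ 1)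
    (hy : ‖Complex.log (planar x y)‖ ≤ ‖Complex.log (planar x w)‖)
    (hz : ‖Complex.log (planar x z)‖ ≤ ‖Complex.log (planar x w)‖) : False := by
  obtain ⟨s, t, hs, ht, hst, rfl⟩ := hw
  set w := s • y + t • z with hwdef
  have hre : (planar x w).re = s * (planar x y).re + t * (planar x z).re := by
    rw [hwdef, planar_add_re, planar_smul_re, planar_smul_re]
  have him : (planar x w).im ≤ s * (planar x y).im + t * (planar x z).im := by
    have := planar_add_im (x := x) (s • y) (t • z)
    rwa [planar_smul_im, planar_smul_im, abs_of_pos hs, abs_of_pos ht] at this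
  have hwp := planar_ne_zero hx hw0
  set α := Real.log ‖planar x w‖ * Real.cos (planar x w).arg
    - (planar x w).arg * Real.sin (planar x w).arg
  set β := Real.log ‖planar x w‖ * Real.sin (planar x w).arg
    + (planar x w).arg * Real.cos (planar x w).arg
  have hβ : 0 ≤ β := by
    refine Real.mul_sin_add_mul_cos_nonneg ?_ (Complex.arg_nonneg_iff.2 (planar_im_nonneg x w))
    rw [← Complex.sq_norm_log]
    exact pow_le_one₀ (norm_nonneg _) h1
  have key : ∀ v : E, v ≠ 0 → ‖Complex.log (planar x v)‖ ≤ ‖Complex.log (planar x w)‖ →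
      α * ((planar x v).re - (planar x w).re) + β * ((planar x v).im - (planar x w).im) ≤ 0 ∧
      (α * ((planar x v).re - (planar x w).re) + β * ((planar x v).im - (planar x w).im) = 0 →
        planar x v = planar x w) := by
    intro v hv hvw
    by_cases h : planar x v = planar x w
    · simp [h]
    · have := Complex.tangent_lt (planar_ne_zero hx hv) hwp h1 hvw h
      exact ⟨this.le, fun h0 => absurd h0 this.ne⟩
  obtain ⟨ky, ky'⟩ := key y hy0 hy
  obtain ⟨kz, kz'⟩ := key z hz0 hz
  have hsum : 0 ≤ s * (α * ((planar x y).re - (planar x w).re)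
        + β * ((planar x y).im - (planar x w).im))
      + t * (α * ((planar x z).re - (planar x w).re)
        + β * ((planar x z).im - (planar x w).im)) := by
    have e : s * (α * ((planar x y).re - (planar x w).re)
        + β * ((planar x y).im - (planar x w).im))
      + t * (α * ((planar x z).re - (planar x w).re)
        + β * ((planar x z).im - (planar x w).im))
      = α * (s * (planar x y).re + t * (planar x z).re - (s + t) * (planar x w).re)
        + β * (s * (planar x y).im + t * (planar x z).im - (s + t) * (planar x w).im) := by ring
    rw [e, hst, ← hre]
    simp only [one_mul, sub_self, mul_zero, zero_add]
    exact mul_nonneg hβ (sub_nonneg.2 him)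
  have ey := ky' (by nlinarith)
  have ez := kz' (by nlinarith)
  have hx0 : ‖x‖ ≠ 0 := norm_ne_zero_iff.2 hx
  have hn : ∀ v : E, planar x v = planar x w → ‖v‖ = ‖w‖ := fun v hv => by
    have := congrArg norm hv
    rw [norm_planar hx, norm_planar hx] at this
    field_simp at this
    exact this
  have := norm_combo_lt_of_ne (hn y ey).le (hn z ez).le hyz hs ht hst
  exact lt_irrefl _ this

theorem planar_re_pos {x z : E} (hx : x ≠ 0) (hz : z ≠ 0)
    (h : ‖Complex.log (planar x z)‖ ≤ 1) : 0 < (planar x z).re := by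
  have h1 := (Complex.abs_im_le_norm (Complex.log (planar x z))).trans h
  rw [Complex.log_im] at h1
  rw [← Complex.norm_mul_cos_arg]
  have h2 := abs_le.1 h1
  exact mul_pos (norm_pos_iff.2 (planar_ne_zero hx hz)) (Real.cos_pos_of_mem_Ioo
    ⟨by linarith [Real.pi_gt_three], by linarith [Real.pi_gt_three]⟩)

theorem convex_logBall {x : E} (hx : x ≠ 0) {M : ℝ} (hM : M ≤ 1) : Convex ℝ (logBall x M) := by
  refine convex_iff_openSegment_subset.2 fun y hy z hz w hw => ?_
  rcases eq_or_ne y z with rfl | hyz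
  · rw [openSegment_same] at hw
    rw [mem_singleton_iff.1 hw]; exact hy
  have hypos := planar_re_pos hx hy.1 (hy.2.le.trans hM)
  have hzpos := planar_re_pos hx hz.1 (hz.2.le.trans hM)
  have hseg : ∀ v ∈ segment ℝ y z, v ≠ 0 := by
    rintro v ⟨s, t, hs, ht, hst, rfl⟩ h0
    have h1 : (planar x (s • y + t • z)).re = s * (planar x y).re + t * (planar x z).re := by
      rw [planar_add_re, planar_smul_re, planar_smul_re]
    rw [h0] at h1
    have h2 : (planar x (0 : E)).re = 0 := by simp [planar]
    rcases hs.eq_or_lt with rfl | hs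
    · have : t = 1 := by linarith
      subst this
      linarith
    · nlinarith [mul_pos hs hypos, mul_nonneg ht hzpos.le]
  refine ⟨hseg w (openSegment_subset_segment ℝ _ _ hw), ?_⟩
  by_contra! hwM
  rcases le_or_gt ‖Complex.log (planar x w)‖ 1 with h1 | h1
  · exact openSegment_norm_log_lt hx hy.1 hz.1
      (hseg w (openSegment_subset_segment ℝ _ _ hw)) hyz hw h1 (hy.2.le.trans hwM)
      (hz.2.le.trans hwM)
  -- The tangent argument needs `‖log‖ ≤ 1`, so `w` is replaced by a point between `y` and `w` at
  -- which the value is exactly `1`.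
  · rw [openSegment_eq_image_lineMap] at hw
    obtain ⟨τ, hτ, rfl⟩ := hw
    have hmem : ∀ r ∈ Icc 0 τ, AffineMap.lineMap y z r ∈ segment ℝ y z := fun r hr => by
      rw [segment_eq_image_lineMap]; exact ⟨r, ⟨hr.1, hr.2.trans hτ.2.le⟩, rfl⟩
    have hcont : ContinuousOn
        (fun r : ℝ => ‖Complex.log (planar x (AffineMap.lineMap y z r))‖) (Icc 0 τ) := fun r hr =>
      ((continuousAt_log_planar hx (hseg _ (hmem r hr))).norm.comp_of_eq
        (AffineMap.lineMap_continuous.continuousAt) rfl).continuousWithinAt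
    obtain ⟨r, hr, hr1⟩ := intermediate_value_Icc hτ.1.le hcont
      (show (1 : ℝ) ∈ Icc _ _ by
        refine ⟨?_, h1.le⟩
        simp only [AffineMap.lineMap_apply_zero]
        exact hy.2.le.trans hM)
    simp only at hr1
    have hr0 : r ≠ 0 := by
      rintro rfl
      rw [AffineMap.lineMap_apply_zero] at hr1
      linarith [hy.2]
    refine openSegment_norm_log_lt hx hy.1 hz.1 (hseg _ (hmem r hr)) hyz
      (w := AffineMap.lineMap y z r) ?_ hr1.le ?_ ?_
    · rw [openSegment_eq_image_lineMap]
      exact ⟨r, ⟨lt_of_le_of_ne hr.1 hr0.symm, hr.2.trans_lt hτ.2⟩, rfl⟩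
    · rw [hr1]; exact hy.2.le.trans hM
    · rw [hr1]; exact hz.2.le.trans hM

theorem isStrictlyConvex_logBall {x : E} (hx : x ≠ 0) {M : ℝ} (hM : M ≤ 1) :
    IsStrictlyConvex (logBall x M) := by
  intro y hy z hz hyz w hw
  rw [(isOpen_logBall hx M).interior_eq]
  have hwc := (convex_logBall hx hM).closure.openSegment_subset hy hz hw
  obtain ⟨hw0, hwM⟩ := mem_closure_logBall hx hwc
  obtain ⟨hy0, hyM⟩ := mem_closure_logBall hx hy
  obtain ⟨hz0, hzM⟩ := mem_closure_logBall hx hz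
  refine ⟨hw0, lt_of_le_of_ne hwM fun h => ?_⟩
  exact openSegment_norm_log_lt hx hy0 hz0 hw0 hyz hw (h.le.trans hM) (h ▸ hyM) (h ▸ hzM)

theorem Real.cos_le_exp_neg_sq_div_two {t : ℝ} (h0 : 0 ≤ t) (h1 : t < Real.pi / 2) :
    Real.cos t ≤ Real.exp (-(t ^ 2 / 2)) := by
  have hanti : AntitoneOn (fun t => Real.cos t * Real.exp (t ^ 2 / 2)) (Icc 0 t) := by
    refine antitoneOn_of_deriv_nonpos (convex_Icc 0 t) (by fun_prop) (by fun_prop) fun r hr => ?_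
    rw [interior_Icc] at hr
    have hd : HasDerivAt (fun t => Real.cos t * Real.exp (t ^ 2 / 2))
        (-Real.sin r * Real.exp (r ^ 2 / 2)
          + Real.cos r * (Real.exp (r ^ 2 / 2) * ((2 : ℕ) * r ^ (2 - 1) / 2))) r :=
      (Real.hasDerivAt_cos r).mul ((hasDerivAt_pow 2 r).div_const 2).exp
    rw [hd.deriv]
    have hc : 0 < Real.cos r := Real.cos_pos_of_mem_Ioo
      ⟨by linarith [hr.1, Real.pi_pos], hr.2.trans h1⟩
    have ht := Real.lt_tan hr.1 (hr.2.trans h1)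
    rw [Real.tan_eq_sin_div_cos, lt_div_iff₀ hc] at ht
    have : -Real.sin r * Real.exp (r ^ 2 / 2)
          + Real.cos r * (Real.exp (r ^ 2 / 2) * ((2 : ℕ) * r ^ (2 - 1) / 2))
        = Real.exp (r ^ 2 / 2) * (r * Real.cos r - Real.sin r) := by
      push_cast; ring
    rw [this]
    exact mul_nonpos_of_nonneg_of_nonpos (Real.exp_pos _).le (by linarith)
  have h2 := hanti ⟨le_rfl, h0⟩ ⟨h0, le_rfl⟩ h0
  simp only [Real.cos_zero, one_mul] at h2
  rw [Real.exp_neg, ← one_div, le_div_iff₀ (Real.exp_pos _)]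
  simpa using h2

theorem log_planar_smul_add_smul {x e : E} (hx : x ≠ 0) (he : inner ℝ x e = 0) (hn : ‖e‖ = ‖x‖)
    {p q : ℝ} (hq0 : 0 ≤ q) (hq : q ≤ Real.pi) :
    Complex.log (planar x ((Real.exp p * Real.cos q) • x + (Real.exp p * Real.sin q) • e))
      = ⟨p, q⟩ := by
  have h1 : Complex.exp ⟨p, q⟩ = ⟨Real.exp p * Real.cos q, Real.exp p * Real.sin q⟩ :=
    Complex.ext (by simp [Complex.exp_re]) (by simp [Complex.exp_im])
  have h2 := planar_smul_add_smul hx he hn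
    (c := ⟨Real.exp p * Real.cos q, Real.exp p * Real.sin q⟩)
    (mul_nonneg (Real.exp_pos p).le (Real.sin_nonneg_of_nonneg_of_le_pi hq0 hq))
  simp only at h2
  rw [h2, ← h1, Complex.log_exp]
  · simp only; linarith [Real.pi_pos]
  · exact hq

theorem not_convex_logBall {x : E} (hx : x ≠ 0) (hE : ∃ e : E, inner ℝ x e = 0 ∧ ‖e‖ = ‖x‖) {M : ℝ}
    (hM : 1 < M) : ¬ Convex ℝ (logBall x M) := by
  intro hconv
  obtain ⟨e, he, hn⟩ := hE
  -- The points with logarithm `-M + ℓ + it`, for `ℓ = -log (cos t)`, taken in the opposite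
  -- directions `e` and `-e`, have midpoint `exp (-M) x`, which is not in the ball. They are in the
  -- ball because `t² ≤ 2ℓ` and `ℓ < 2 (M - 1)` give `(M - ℓ)² + t² < M²`.
  obtain ⟨t, ht0, ht1, ht2⟩ : ∃ t : ℝ, 0 < t ∧ t < Real.pi / 2 ∧
      -Real.log (Real.cos t) < 2 * (M - 1) := by
    have hc : ContinuousAt (fun t : ℝ => -Real.log (Real.cos t)) 0 :=
      (Real.continuous_cos.continuousAt.log (by simp)).neg
    have h1 : ∀ᶠ t in 𝓝[>] (0 : ℝ), -Real.log (Real.cos t) < 2 * (M - 1) :=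
      nhdsWithin_le_nhds (hc.eventually (gt_mem_nhds (by simp; linarith)))
    have h2 : ∀ᶠ t in 𝓝[>] (0 : ℝ), t ∈ Ioo 0 (Real.pi / 2) :=
      Ioo_mem_nhdsGT (by positivity)
    obtain ⟨t, a, b⟩ := (h1.and h2).exists
    exact ⟨t, b.1, b.2, a⟩
  have hcos : 0 < Real.cos t := Real.cos_pos_of_mem_Ioo ⟨by linarith, ht1⟩
  set ℓ := -Real.log (Real.cos t) with hℓ
  have h3 : t ^ 2 / 2 ≤ ℓ := by
    have := Real.log_le_log hcos (Real.cos_le_exp_neg_sq_div_two ht0.le ht1)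
    rw [Real.log_exp] at this
    linarith
  have h4 : 0 < ℓ := lt_of_lt_of_le (by positivity) h3
  have hmem : ∀ e : E, inner ℝ x e = 0 → ‖e‖ = ‖x‖ →
      (Real.exp (-M + ℓ) * Real.cos t) • x + (Real.exp (-M + ℓ) * Real.sin t) • e
        ∈ logBall x M := by
    intro e he hn
    have hlog := log_planar_smul_add_smul hx he hn (p := -M + ℓ) ht0.le
      (by linarith [Real.pi_pos])
    refine ⟨fun h0 => ?_, ?_⟩
    · have := norm_smul_add_smul he hn
        ⟨Real.exp (-M + ℓ) * Real.cos t, Real.exp (-M + ℓ) * Real.sin t⟩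
      simp only at this
      rw [h0, norm_zero, eq_comm, mul_eq_zero, norm_eq_zero, norm_eq_zero] at this
      rcases this with h | h
      · exact hx h
      · have := congrArg Complex.re h
        have : 0 < Real.exp (-M + ℓ) * Real.cos t := by positivity
        simp_all
    · rw [hlog]
      refine lt_of_pow_lt_pow_left₀ 2 (by linarith) ?_
      rw [Complex.sq_norm, Complex.normSq_apply]
      nlinarith
  have h5 := hconv (hmem e he hn) (hmem (-e) (by rw [inner_neg_right, he, neg_zero])
    (by rw [norm_neg, hn])) (a := 1 / 2) (b := 1 / 2) (by norm_num) (by norm_num) (by norm_num)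
  have h6 : Real.exp (-M + ℓ) * Real.cos t = Real.exp (-M) := by
    rw [Real.exp_add, hℓ, Real.exp_neg (Real.log _), Real.exp_log hcos]
    field_simp
  have h7 : (1 / 2 : ℝ) • ((Real.exp (-M + ℓ) * Real.cos t) • x
        + (Real.exp (-M + ℓ) * Real.sin t) • e)
      + (1 / 2 : ℝ) • ((Real.exp (-M + ℓ) * Real.cos t) • x
        + (Real.exp (-M + ℓ) * Real.sin t) • -e)
      = (Real.exp (-M) * Real.cos 0) • x + (Real.exp (-M) * Real.sin 0) • e := by
    rw [h6, Real.cos_zero, Real.sin_zero]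
    module
  rw [h7] at h5
  have h8 := h5.2
  rw [log_planar_smul_add_smul hx he hn le_rfl Real.pi_pos.le] at h8
  have h9 : ‖(⟨-M, 0⟩ : ℂ)‖ = M := by
    have : (⟨-M, 0⟩ : ℂ) = ((-M : ℝ) : ℂ) := rfl
    rw [this, Complex.norm_real, norm_neg, Real.norm_of_nonneg (by linarith)]
  linarith

end Ball

/-! ### The constant `κ` and its numerical value. -/

section Kappa

/-- The function on the left-hand side of the equation for `κ`, in the variable `√(p² - 1)`. -/
noncomputable def cosAddMulSin (s : ℝ) : ℝ := Real.cos s + s * Real.sin s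

theorem hasDerivAt_cosAddMulSin (s : ℝ) : HasDerivAt cosAddMulSin (s * Real.cos s) s := by
  have := (Real.hasDerivAt_cos s).add ((hasDerivAt_id s).mul (Real.hasDerivAt_sin s))
  refine this.congr_deriv ?_
  simp

theorem continuous_cosAddMulSin : Continuous cosAddMulSin :=
  continuous_iff_continuousAt.2 fun s => (hasDerivAt_cosAddMulSin s).continuousAt

theorem strictAntiOn_cosAddMulSin :
    StrictAntiOn cosAddMulSin (Icc (Real.pi / 2) Real.pi) := by
  refine strictAntiOn_of_deriv_neg (convex_Icc _ _) continuous_cosAddMulSin.continuousOn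
    fun s hs => ?_
  rw [interior_Icc] at hs
  rw [(hasDerivAt_cosAddMulSin s).deriv]
  exact mul_neg_of_pos_of_neg (by linarith [hs.1, Real.pi_pos])
    (Real.cos_neg_of_pi_div_two_lt_of_lt hs.1 (by linarith [hs.2, Real.pi_pos]))

theorem one_le_cosAddMulSin {s : ℝ} (h0 : 0 ≤ s) (h1 : s ≤ Real.pi / 2) :
    1 ≤ cosAddMulSin s := by
  have hc : 0 ≤ Real.cos s := Real.cos_nonneg_of_neg_pi_div_two_le_of_le
    (by linarith [Real.pi_pos]) h1
  have hs : 0 ≤ Real.sin s := Real.sin_nonneg_of_nonneg_of_le_pi h0 (by linarith [Real.pi_pos])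
  have h2 := Real.sin_le h0
  have h3 := Real.sin_sq_add_cos_sq s
  have h4 := Real.cos_le_one s
  unfold cosAddMulSin
  nlinarith

theorem Real.exp_neg_one_lt_one : Real.exp (-1) < 1 :=
  (Real.exp_lt_exp.2 (by norm_num)).trans_eq Real.exp_zero

/-- Real and imaginary parts of the Taylor bound for `exp (ix)` with eight terms; `35840 = 8! · 8 /
9`. -/
theorem abs_cos_sin_sub_taylor_le {x : ℝ} (hx0 : 0 ≤ x) (hx : x ≤ 1) :
    |Real.cos x - (1 - x ^ 2 / 2 + x ^ 4 / 24 - x ^ 6 / 720)| ≤ x ^ 8 / 35840 ∧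
    |Real.sin x - (x - x ^ 3 / 6 + x ^ 5 / 120 - x ^ 7 / 5040)| ≤ x ^ 8 / 35840 := by
  have hn : ‖(x * Complex.I : ℂ)‖ = x := by simp [abs_of_nonneg hx0]
  have h := Complex.exp_bound (x := x * Complex.I) (by rw [hn]; exact hx) (n := 8) (by norm_num)
  rw [hn] at h
  have e : Complex.exp (x * Complex.I) - ∑ m ∈ Finset.range 8, (x * Complex.I) ^ m / m.factorial
      = ⟨Real.cos x - (1 - x ^ 2 / 2 + x ^ 4 / 24 - x ^ 6 / 720),
        Real.sin x - (x - x ^ 3 / 6 + x ^ 5 / 120 - x ^ 7 / 5040)⟩ := by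
    rw [Complex.mk_eq_add_mul_I, Complex.exp_mul_I]
    have h2 : Complex.I ^ 2 = -1 := Complex.I_sq
    have h3 : Complex.I ^ 3 = -Complex.I := by rw [pow_succ, h2]; ring
    have h4 : Complex.I ^ 4 = 1 := Complex.I_pow_four
    have h5 : Complex.I ^ 5 = Complex.I := by rw [pow_succ, h4]; ring
    have h6 : Complex.I ^ 6 = -1 := by rw [pow_succ, h5, ← h2]; ring
    have h7 : Complex.I ^ 7 = -Complex.I := by rw [pow_succ, h6]; ring
    simp only [Finset.sum_range_succ, Finset.sum_range_zero, mul_pow, h2, h3, h4, h5, h6, h7,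
      Nat.factorial]
    push_cast
    ring
  rw [e] at h
  have hc : x ^ 8 * (((8 : ℕ).succ : ℝ) * (((8 : ℕ).factorial : ℝ) * (8 : ℕ))⁻¹)
      = x ^ 8 / 35840 := by
    simp only [Nat.factorial]; push_cast; ring
  rw [hc] at h
  exact ⟨(Complex.abs_re_le_norm _).trans h, (Complex.abs_im_le_norm _).trans h⟩

theorem cosAddMulSin_eq_pi_sub (s : ℝ) :
    cosAddMulSin s = s * Real.sin (Real.pi - s) - Real.cos (Real.pi - s) := by
  rw [Real.sin_pi_sub, Real.cos_pi_sub, cosAddMulSin]; ring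

/-- The argument is chosen so that `√(s ^ 2 + 1)` stays above `2.832965`. Reflection at `π` moves it
to about `0.49099`, where the Taylor polynomials are accurate. -/
theorem exp_neg_one_lt_cosAddMulSin : Real.exp (-1) < cosAddMulSin 2.650603 := by
  have hpi := Real.pi_gt_d6
  have hpi' := Real.pi_lt_d6
  obtain ⟨h1, h2⟩ := abs_cos_sin_sub_taylor_le (x := 0.490989) (by norm_num) (by norm_num)
  have hs : Real.sin 0.490989 ≤ Real.sin (Real.pi - 2.650603) :=
    Real.sin_le_sin_of_le_of_le_pi_div_two (by linarith) (by linarith) (by linarith)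
  have hc : Real.cos (Real.pi - 2.650603) ≤ Real.cos 0.490989 :=
    Real.cos_le_cos_of_nonneg_of_le_pi (by norm_num) (by linarith) (by linarith)
  have he : Real.exp (-1) < 0.3678795 := by
    rw [Real.exp_neg]
    refine (inv_lt_inv₀ (Real.exp_pos 1) (by norm_num)).2 Real.exp_one_gt_d9 |>.trans ?_
    norm_num
  rw [cosAddMulSin_eq_pi_sub]
  rw [abs_le] at h1 h2
  norm_num at h1 h2 hs hc ⊢
  linarith

theorem cosAddMulSin_lt_exp_neg_one : cosAddMulSin 2.650612 < Real.exp (-1) := by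
  have hpi := Real.pi_gt_d6
  have hpi' := Real.pi_lt_d6
  obtain ⟨h1, h2⟩ := abs_cos_sin_sub_taylor_le (x := 0.490981) (by norm_num) (by norm_num)
  have hs : Real.sin (Real.pi - 2.650612) ≤ Real.sin 0.490981 :=
    Real.sin_le_sin_of_le_of_le_pi_div_two (by linarith) (by linarith) (by linarith)
  have hc : Real.cos 0.490981 ≤ Real.cos (Real.pi - 2.650612) :=
    Real.cos_le_cos_of_nonneg_of_le_pi (by linarith) (by linarith) (by linarith)
  have he : 0.3678794 < Real.exp (-1) := by
    rw [Real.exp_neg]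
    refine lt_trans ?_ ((inv_lt_inv₀ (by norm_num) (Real.exp_pos 1)).2 Real.exp_one_lt_d9)
    norm_num
  rw [cosAddMulSin_eq_pi_sub]
  rw [abs_le] at h1 h2
  norm_num at h1 h2 hs hc ⊢
  linarith

theorem kappaEquation_iff (p : ℝ) :
    KappaEquation p ↔ cosAddMulSin (√(p ^ 2 - 1)) = Real.exp (-1) := Iff.rfl

theorem sqrt_sq_sub_one_lt_pi {p : ℝ} (h : p ∈ Icc 1 Real.pi) :
    √(p ^ 2 - 1) < Real.pi := by
  rw [Real.sqrt_lt' Real.pi_pos]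
  nlinarith [h.1, h.2]

/-- On `[0, π / 2]` the function is at least `1`, so comparisons with `1/e` take place where it is
strictly decreasing. -/
theorem pi_div_two_lt_sqrt_of_le_exp {p : ℝ}
    (h : cosAddMulSin (√(p ^ 2 - 1)) ≤ Real.exp (-1)) : Real.pi / 2 < √(p ^ 2 - 1) := by
  by_contra! hle
  linarith [one_le_cosAddMulSin (Real.sqrt_nonneg _) hle, Real.exp_neg_one_lt_one]

theorem exp_lt_cosAddMulSin_of_lt {κ p : ℝ} (hκ : κ ∈ Icc 1 Real.pi) (hk : KappaEquation κ)
    (hp : 1 ≤ p) (hpκ : p < κ) : Real.exp (-1) < cosAddMulSin (√(p ^ 2 - 1)) := by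
  by_contra! hle
  have h1 := pi_div_two_lt_sqrt_of_le_exp hle
  have h2 : √(p ^ 2 - 1) < √(κ ^ 2 - 1) := by
    refine Real.sqrt_lt_sqrt (by nlinarith) (by nlinarith)
  have h3 := (sqrt_sq_sub_one_lt_pi hκ).le
  have := strictAntiOn_cosAddMulSin ⟨h1.le, h2.le.trans h3⟩ ⟨(h1.trans h2).le, h3⟩ h2
  rw [(kappaEquation_iff κ).1 hk] at this
  linarith

theorem cosAddMulSin_lt_exp_of_lt {κ p : ℝ} (hκ : κ ∈ Icc 1 Real.pi) (hk : KappaEquation κ)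
    (hpκ : κ < p) (hp : p ≤ Real.pi) : cosAddMulSin (√(p ^ 2 - 1)) < Real.exp (-1) := by
  have h1 := pi_div_two_lt_sqrt_of_le_exp ((kappaEquation_iff κ).1 hk).le
  have h2 : √(κ ^ 2 - 1) < √(p ^ 2 - 1) := by
    refine Real.sqrt_lt_sqrt (by nlinarith [hκ.1]) (by nlinarith [hκ.1])
  have h3 := (sqrt_sq_sub_one_lt_pi (p := p) ⟨hκ.1.trans hpκ.le, hp⟩).le
  have := strictAntiOn_cosAddMulSin ⟨h1.le, h2.le.trans h3⟩ ⟨(h1.trans h2).le, h3⟩ h2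
  rwa [(kappaEquation_iff κ).1 hk] at this

theorem exists_kappa : ∃ κ : ℝ, κ ∈ Icc 1 Real.pi ∧ KappaEquation κ ∧
    (∀ p ∈ Icc 1 Real.pi, KappaEquation p → p = κ) ∧ |κ - 2.83297| ≤ 0.000005 := by
  have hpi := Real.pi_gt_three
  obtain ⟨s, hs, hsk⟩ := intermediate_value_Icc' (show (2.650603 : ℝ) ≤ 2.650612 by norm_num)
    continuous_cosAddMulSin.continuousOn
    ⟨cosAddMulSin_lt_exp_neg_one.le, exp_neg_one_lt_cosAddMulSin.le⟩
  have hs0 : 0 ≤ s := by linarith [hs.1]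
  have h1 : 2.832965 ≤ √(s ^ 2 + 1) := Real.le_sqrt_of_sq_le (by norm_num; nlinarith [hs.1])
  have h2 : √(s ^ 2 + 1) ≤ 2.832975 :=
    (Real.sqrt_le_left (by norm_num)).2 (by norm_num; nlinarith [hs.2])
  have hmem : √(s ^ 2 + 1) ∈ Icc 1 Real.pi := ⟨by linarith, by linarith⟩
  have hk : KappaEquation (√(s ^ 2 + 1)) := by
    rw [kappaEquation_iff, Real.sq_sqrt (by positivity), add_sub_cancel_right, Real.sqrt_sq hs0]
    exact hsk
  refine ⟨_, hmem, hk, fun p hp hpk => ?_, abs_le.2 ⟨by linarith, by linarith⟩⟩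
  rcases lt_trichotomy p (√(s ^ 2 + 1)) with h | h | h
  · exact absurd ((kappaEquation_iff p).1 hpk) (exp_lt_cosAddMulSin_of_lt hmem hk hp.1 h).ne'
  · exact h
  · exact absurd ((kappaEquation_iff p).1 hpk) (cosAddMulSin_lt_exp_of_lt hmem hk h hp.2).ne

end Kappa

/-! ### The derivative of `‖log‖ ^ 2` along rays from `1`. -/

section RadialDerivative

theorem Real.sin_le_tangent {t u : ℝ} (ht : t ∈ Icc 0 Real.pi) (hu : u ∈ Icc 0 Real.pi) :
    Real.sin t ≤ Real.sin u + Real.cos u * (t - u) := by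
  rcases le_total u t with h | h
  · have := (convex_Icc u t).image_sub_le_mul_sub_of_deriv_le Real.continuous_sin.continuousOn
      Real.differentiable_sin.differentiableOn (C := Real.cos u) (fun r hr => by
        rw [interior_Icc] at hr
        rw [Real.deriv_sin]
        exact Real.cos_le_cos_of_nonneg_of_le_pi hu.1 (hr.2.le.trans ht.2) hr.1.le)
      u ⟨le_rfl, h⟩ t ⟨h, le_rfl⟩ h
    linarith
  · have := (convex_Icc t u).mul_sub_le_image_sub_of_le_deriv Real.continuous_sin.continuousOn
      Real.differentiable_sin.differentiableOn (C := Real.cos u) (fun r hr => by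
        rw [interior_Icc] at hr
        rw [Real.deriv_sin]
        exact Real.cos_le_cos_of_nonneg_of_le_pi (ht.1.trans hr.1.le) hu.2 hr.2.le)
      t ⟨le_rfl, h⟩ u ⟨h, le_rfl⟩ h
    linarith

/-- On the arc of the circle of radius `p` with `q ≥ π / 2`, the function `r cos q + q sin q` is
minimal at `r = 1`. -/
theorem cosAddMulSin_le {r q p : ℝ} (hr : 0 ≤ r) (hq : Real.pi / 2 ≤ q) (hp : 1 ≤ p)
    (hpp : p ≤ Real.pi) (h : r ^ 2 + q ^ 2 = p ^ 2) :
    cosAddMulSin (√(p ^ 2 - 1)) ≤ r * Real.cos q + q * Real.sin q := by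
  have hpi := Real.pi_pos
  have hp0 : 0 < p := by linarith
  have hq0 : 0 ≤ q := by linarith
  have hqp : q ≤ p := by nlinarith
  -- In polar coordinates the expression is `p cos (q - t)`, where `q - t = p sin t - t` is largest
  -- when `p cos t = 1`, that is `r = 1`, by concavity of `sin`.
  obtain ⟨t, ht, hts, htc⟩ : ∃ t ∈ Icc 0 (Real.pi / 2),
      p * Real.sin t = q ∧ p * Real.cos t = r := by
    refine ⟨Real.arcsin (q / p),
      ⟨Real.arcsin_nonneg.2 (by positivity), Real.arcsin_le_pi_div_two _⟩,
      ?_, ?_⟩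
    · rw [Real.sin_arcsin (by linarith [show 0 ≤ q / p by positivity]) ((div_le_one hp0).2 hqp)]
      field_simp
    · rw [Real.cos_arcsin, show 1 - (q / p) ^ 2 = (r / p) ^ 2 by field_simp; linarith,
        Real.sqrt_sq (by positivity)]
      field_simp
  set s := √(p ^ 2 - 1) with hs
  have hs2 : s ^ 2 = p ^ 2 - 1 := Real.sq_sqrt (by nlinarith)
  have hs0 : 0 ≤ s := Real.sqrt_nonneg _
  have hsp : s < Real.pi := sqrt_sq_sub_one_lt_pi ⟨hp, hpp⟩
  obtain ⟨u, hu, hus, huc⟩ : ∃ u ∈ Icc 0 Real.pi, p * Real.sin u = s ∧ p * Real.cos u = 1 := by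
    refine ⟨Real.arccos (1 / p), ⟨Real.arccos_nonneg _, Real.arccos_le_pi _⟩, ?_, ?_⟩
    · rw [Real.sin_arccos, show 1 - (1 / p) ^ 2 = (s / p) ^ 2 by field_simp; linarith,
        Real.sqrt_sq (by positivity)]
      field_simp
    · rw [Real.cos_arccos (by linarith [show 0 ≤ 1 / p by positivity]) ((div_le_one hp0).2 hp)]
      field_simp
  have htan := mul_le_mul_of_nonneg_left
    (Real.sin_le_tangent (t := t) ⟨ht.1, ht.2.trans (by linarith)⟩ hu) hp0.le
  have hle : q - t ≤ s - u := by
    have : p * (Real.sin u + Real.cos u * (t - u)) = s + 1 * (t - u) := by rw [← hus, ← huc]; ring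
    linarith
  have hcos := Real.cos_le_cos_of_nonneg_of_le_pi (show 0 ≤ q - t by linarith [ht.2])
    (show s - u ≤ Real.pi by linarith [hu.1]) hle
  have e1 : r * Real.cos q + q * Real.sin q = p * Real.cos (q - t) := by
    rw [Real.cos_sub]; nth_rewrite 1 [← htc]; nth_rewrite 2 [← hts]; ring
  have e2 : cosAddMulSin s = p * Real.cos (s - u) := by
    rw [Real.cos_sub, cosAddMulSin]
    calc Real.cos s + s * Real.sin s = 1 * Real.cos s + s * Real.sin s := by ring
      _ = (p * Real.cos u) * Real.cos s + (p * Real.sin u) * Real.sin s := by rw [huc, hus]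
      _ = _ := by ring
  rw [e1, e2]
  exact mul_le_mul_of_nonneg_left hcos hp0.le

theorem Real.neg_exp_neg_one_le (r : ℝ) : -Real.exp (-1) ≤ r * Real.exp r := by
  have := Real.mul_exp_neg_le_exp_neg_one (-r)
  rw [neg_neg] at this
  linarith

theorem Real.neg_exp_neg_one_lt {r : ℝ} (hr : r ≠ -1) : -Real.exp (-1) < r * Real.exp r := by
  have h1 : -r - 1 + 1 < Real.exp (-r - 1) :=
    Real.add_one_lt_exp fun h => hr (by linarith)
  have h2 : Real.exp (-r - 1) * Real.exp r = Real.exp (-1) := by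
    rw [← Real.exp_add]; ring_nf
  nlinarith [Real.exp_pos r]

/-- The sign of the radial derivative of `‖log z‖` with respect to the centre `1`, at the point
`z = exp (r + i q)`. -/
theorem radial_pos_or {κ r q : ℝ} (hκ : κ ∈ Icc 1 Real.pi) (hκ' : κ < Real.pi)
    (hk : KappaEquation κ) (hq : 0 ≤ q) (h : r ^ 2 + q ^ 2 ≤ κ ^ 2) (hne : r ≠ 0 ∨ q ≠ 0) :
    0 < r * Real.exp r - r * Real.cos q + q * Real.sin q ∨
      (0 ≤ r * Real.exp r - r * Real.cos q + q * Real.sin q ∧ r = -1 ∧ r ^ 2 + q ^ 2 = κ ^ 2) := by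
  have hpi := Real.pi_gt_three
  have hqκ : q ≤ κ := abs_le_of_sq_le_sq' (by nlinarith [sq_nonneg r]) (by linarith [hκ.1]) |>.2
  have hqpi : q < Real.pi := by linarith
  have hsin : 0 ≤ q * Real.sin q :=
    mul_nonneg hq (Real.sin_nonneg_of_nonneg_of_le_pi hq hqpi.le)
  rcases le_or_gt 0 r with hr | hr
  · left
    rcases hr.eq_or_lt with rfl | hr
    · have hq0 : 0 < q := lt_of_le_of_ne hq (by simpa [eq_comm] using hne)
      have := mul_pos hq0 (Real.sin_pos_of_pos_of_lt_pi hq0 hqpi)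
      simpa using this
    · have h1 : 1 < Real.exp r := Real.one_lt_exp_iff.2 hr
      nlinarith [Real.cos_le_one q]
  · rcases le_or_gt q (Real.pi / 2) with hq2 | hq2
    · left
      rcases le_or_gt (-1) r with hr1 | hr1
      · have h1 : Real.exp r < 1 := (Real.exp_lt_exp.2 hr).trans_eq Real.exp_zero
        have h2 := Real.one_sub_sq_div_two_le_cos (x := q)
        have h3 := Real.mul_le_sin hq hq2
        have h4 : 1 / 2 * q ≤ Real.sin q := by
          refine le_trans (mul_le_mul_of_nonneg_right ?_ hq) h3
          rw [div_le_div_iff₀ (by norm_num) Real.pi_pos]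
          linarith [Real.pi_lt_four]
        have h5 : 0 < r * (Real.exp r - 1) := mul_pos_of_neg_of_neg hr (by linarith)
        have h6 : -(q ^ 2 / 2) ≤ r * (1 - Real.cos q) := by
          nlinarith [Real.cos_le_one q]
        nlinarith
      -- For `r < -1`, `-r cos q ≥ cos q`, so the sum is at least `1 - 1/e`.
      · have h1 := Real.neg_exp_neg_one_le r
        have h2 := one_le_cosAddMulSin hq hq2
        have h3 := Real.exp_neg_one_lt_one
        have hc : 0 ≤ Real.cos q := Real.cos_nonneg_of_neg_pi_div_two_le_of_le (by linarith) hq2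
        unfold cosAddMulSin at h2
        nlinarith
    -- The critical range: `r e^r ≥ -1/e`, and the other two terms are at least `1/e` since `p ≤ κ`.
    -- Both are equalities only if `p = κ` and `r = -1`.
    · set p := √(r ^ 2 + q ^ 2) with hp
      have hp2 : p ^ 2 = r ^ 2 + q ^ 2 := Real.sq_sqrt (by positivity)
      have hp0 : 0 ≤ p := Real.sqrt_nonneg _
      have hp1 : 1 ≤ p := by nlinarith [sq_nonneg r]
      have hpκ : p ≤ κ := abs_le_of_sq_le_sq' (by linarith) (by linarith [hκ.1]) |>.2
      have h1 := cosAddMulSin_le (r := -r) (by linarith) hq2.le hp1 (by linarith)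
        (by rw [neg_sq]; exact hp2.symm)
      rcases hpκ.eq_or_lt with h2 | h2
      · have h3 : cosAddMulSin (√(p ^ 2 - 1)) = Real.exp (-1) := by rw [h2]; exact hk
        rcases eq_or_ne r (-1) with h4 | h4
        · right
          refine ⟨?_, h4, by rw [← hp2, h2]⟩
          linarith [Real.neg_exp_neg_one_le r]
        · left
          linarith [Real.neg_exp_neg_one_lt h4]
      · left
        linarith [Real.neg_exp_neg_one_le r, exp_lt_cosAddMulSin_of_lt hκ hk hp1 h2]

theorem hasDerivAt_norm_log_sq {c : ℂ} {t : ℝ} (hs : 1 + t * c ∈ Complex.slitPlane) :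
    ∃ d, HasDerivAt (fun t : ℝ => ‖Complex.log (1 + t * c)‖ ^ 2) d t ∧
      t * d = 2 * Real.exp (-Real.log ‖1 + t * c‖) *
        (Real.log ‖1 + t * c‖ * Real.exp (Real.log ‖1 + t * c‖)
          - Real.log ‖1 + t * c‖ * Real.cos (1 + t * c).arg
          + (1 + t * c).arg * Real.sin (1 + t * c).arg) := by
  have h1 : HasDerivAt (fun t : ℝ => 1 + (t : ℂ) * c) c t := by
    simpa using ((Complex.ofRealCLM.hasDerivAt (x := t)).mul_const c).const_add 1
  have h2 := (h1.clog_real hs).norm_sq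
  refine ⟨_, h2, ?_⟩
  set n : ℂ := 1 + t * c with hn
  have hn0 : n ≠ 0 := Complex.slitPlane_ne_zero hs
  have hn' : 0 < ‖n‖ := norm_pos_iff.2 hn0
  set ζ := Complex.log n with hζ
  have hexp : Complex.exp ζ = n := Complex.exp_log hn0
  -- The factor `t` eliminates `c`, since `t c = n - 1`; the derivative then depends on `ζ = log n`
  -- alone.
  have e1 : (t : ℂ) * (c / n) = 1 - Complex.exp (-ζ) := by
    rw [Complex.exp_neg, hexp]
    field_simp
    rw [hn]; ring
  have e2 : t * (2 * inner ℝ ζ (c / n)) = 2 * inner ℝ ζ ((t : ℂ) * (c / n)) := by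
    rw [← Complex.real_smul, inner_smul_right]; ring
  have hre : Real.log ‖n‖ = ζ.re := (Complex.log_re n).symm
  have him : n.arg = ζ.im := (Complex.log_im n).symm
  rw [e2, e1, Complex.inner, hre, him]
  simp only [Complex.mul_re, Complex.conj_re, Complex.conj_im, Complex.sub_re, Complex.sub_im,
    Complex.one_re, Complex.one_im, Complex.exp_re, Complex.exp_im, Complex.neg_re, Complex.neg_im,
    Real.cos_neg, Real.sin_neg]
  have e3 : Real.exp (-ζ.re) * Real.exp ζ.re = 1 := by rw [← Real.exp_add]; simp
  linear_combination (-2 * ζ.re) * e3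

theorem Complex.mem_slitPlane_of_norm_log_lt_pi {z : ℂ} (hz : z ≠ 0)
    (h : ‖Complex.log z‖ < Real.pi) : z ∈ Complex.slitPlane := by
  rw [Complex.mem_slitPlane_iff_arg]
  refine ⟨fun h1 => ?_, hz⟩
  have := Complex.abs_im_le_norm (Complex.log z)
  rw [Complex.log_im, h1, abs_of_pos Real.pi_pos] at this
  linarith

theorem deriv_norm_log_sq_pos_or {κ : ℝ} (hκ : κ ∈ Icc 1 Real.pi) (hκ' : κ < Real.pi)
    (hk : KappaEquation κ) {c : ℂ} (hc : c ≠ 0) (hci : 0 ≤ c.im) {t : ℝ} (ht : 0 < t)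
    (hn : 1 + t * c ≠ 0) (hlog : ‖Complex.log (1 + t * c)‖ ≤ κ) :
    ∃ d, HasDerivAt (fun t : ℝ => ‖Complex.log (1 + t * c)‖ ^ 2) d t ∧
      (0 < d ∨ (‖Complex.log (1 + t * c)‖ = κ ∧
        Complex.log (1 + t * c) = ⟨-1, √(κ ^ 2 - 1)⟩)) := by
  have hs := Complex.mem_slitPlane_of_norm_log_lt_pi hn (hlog.trans_lt hκ')
  obtain ⟨d, hd, htd⟩ := hasDerivAt_norm_log_sq hs
  refine ⟨d, hd, ?_⟩
  set n : ℂ := 1 + t * c with hndef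
  have hnim : 0 ≤ n.im := by
    simp only [hndef, Complex.add_im, Complex.one_im, Complex.im_ofReal_mul, zero_add]
    positivity
  have hq : 0 ≤ n.arg := Complex.arg_nonneg_iff.2 hnim
  have hle : Real.log ‖n‖ ^ 2 + n.arg ^ 2 ≤ κ ^ 2 := by
    rw [← Complex.sq_norm_log]
    exact pow_le_pow_left₀ (norm_nonneg _) hlog 2
  have hne : Real.log ‖n‖ ≠ 0 ∨ n.arg ≠ 0 := by
    by_contra! h
    have h1 : Complex.log n = 0 :=
      Complex.ext (by rw [Complex.log_re, h.1]; rfl) (by rw [Complex.log_im, h.2]; rfl)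
    have h2 : n = 1 := by rw [← Complex.exp_log hn, h1, Complex.exp_zero]
    rw [hndef, add_eq_left, mul_eq_zero, Complex.ofReal_eq_zero] at h2
    exact h2.elim ht.ne' hc
  rcases radial_pos_or hκ hκ' hk hq hle hne with h | ⟨-, h1, h2⟩
  · left
    refine pos_of_mul_pos_right (a := t) ?_ ht.le
    rw [htd]
    positivity
  · right
    refine ⟨(sq_eq_sq₀ (norm_nonneg _) (by linarith [hκ.1])).1
      (by rw [Complex.sq_norm_log, h2]), ?_⟩
    refine Complex.ext (by rw [Complex.log_re, h1]) ?_
    rw [Complex.log_im]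
    have h3 : κ ^ 2 - 1 = n.arg ^ 2 := by rw [← h2, h1]; ring
    rw [h3, Real.sqrt_sq hq]

/-- The derivative is controlled only on the sublevel set of `φ b`. Just left of `b` the values are
smaller, so if `φ a ≥ φ b` an interior minimum would lie in that set with derivative zero. -/
theorem lt_of_hasDerivAt_pos_of_le {φ : ℝ → ℝ} {a b : ℝ} (hab : a < b)
    (hc : ContinuousOn φ (Icc a b))
    (h : ∀ t ∈ Ioc a b, φ t ≤ φ b → ∃ d, HasDerivAt φ d t ∧ 0 < d) : φ a < φ b := by
  by_contra! hba
  obtain ⟨d, hd, hd0⟩ := h b ⟨hab, le_rfl⟩ le_rfl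
  obtain ⟨s, hs, hsb⟩ : ∃ s ∈ Ioo a b, φ s < φ b := by
    have h1 := (hasDerivAt_iff_tendsto_slope.1 hd).eventually (lt_mem_nhds hd0)
    have h2 : ∀ᶠ s in 𝓝[<] b, 0 < slope φ b s :=
      nhdsWithin_mono b (fun s (hs : s < b) => hs.ne) h1
    obtain ⟨s, hs1, hs2⟩ := (h2.and (Ioo_mem_nhdsLT hab)).exists
    refine ⟨s, hs2, ?_⟩
    rw [slope_def_field] at hs1
    have := (div_pos_iff.1 hs1).resolve_left fun h => by linarith [h.2, hs2.2]
    linarith [this.1]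
  obtain ⟨m, hm, hmin⟩ := isCompact_Icc.exists_isMinOn ⟨s, hs.1.le, hs.2.le⟩ hc
  have hms : φ m ≤ φ s := hmin ⟨hs.1.le, hs.2.le⟩
  have hma : a < m := lt_of_le_of_ne hm.1 (by rintro rfl; linarith)
  have hmb : m < b := lt_of_le_of_ne hm.2 (by rintro rfl; linarith)
  obtain ⟨d', hd', hd0'⟩ := h m ⟨hma, hm.2⟩ (by linarith)
  have := (hmin.isLocalMin (Icc_mem_nhds hma hmb)).hasDerivAt_eq_zero hd'
  linarith

theorem norm_log_lt_of_lt {κ : ℝ} (hκ : κ ∈ Icc 1 Real.pi) (hκ' : κ < Real.pi)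
    (hk : KappaEquation κ) {c : ℂ} (hci : 0 ≤ c.im) {t : ℝ} (ht : t ∈ Icc (0 : ℝ) 1)
    (hn : 1 + c ≠ 0) (hlog : ‖Complex.log (1 + c)‖ < κ) :
    1 + t * c ≠ 0 ∧ ‖Complex.log (1 + t * c)‖ ≤ ‖Complex.log (1 + c)‖ := by
  have hs := Complex.mem_slitPlane_of_norm_log_lt_pi hn (hlog.trans hκ')
  have hsl : ∀ r ∈ Icc (0 : ℝ) 1, 1 + r * c ∈ Complex.slitPlane := fun r hr => by
    have := StarConvex.add_smul_mem Complex.starConvex_one_slitPlane hs hr.1 hr.2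
    rwa [Complex.real_smul] at this
  refine ⟨Complex.slitPlane_ne_zero (hsl t ht), ?_⟩
  rcases ht.2.eq_or_lt with rfl | ht1
  · simp
  rcases eq_or_ne c 0 with rfl | hc
  · simp
  refine (sq_le_sq₀ (norm_nonneg _) (norm_nonneg _)).1 ?_
  have := lt_of_hasDerivAt_pos_of_le (φ := fun t : ℝ => ‖Complex.log (1 + t * c)‖ ^ 2) ht1
    (fun r hr => by
      obtain ⟨d, hd, -⟩ := hasDerivAt_norm_log_sq (hsl r ⟨ht.1.trans hr.1, hr.2⟩)
      exact hd.continuousAt.continuousWithinAt)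
    (fun r hr hle => by
      simp only [Complex.ofReal_one, one_mul] at hle
      have hle := (sq_le_sq₀ (norm_nonneg _) (norm_nonneg _)).1 hle
      obtain ⟨d, hd, h⟩ := deriv_norm_log_sq_pos_or hκ hκ' hk hc hci (ht.1.trans_lt hr.1)
        (Complex.slitPlane_ne_zero (hsl r ⟨ht.1.trans hr.1.le, hr.2⟩)) (hle.trans hlog.le)
      exact ⟨d, hd, h.resolve_right fun h => by linarith [h.1]⟩)
  simpa using this.le

end RadialDerivative

/-! ### Starlikeness up to `κ` and its failure beyond. -/

section Starlike

variable {E : Type*} [NormedAddCommGroup E] [InnerProductSpace ℝ E]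

theorem starConvex_logBall {κ : ℝ} (hκ : κ ∈ Icc 1 Real.pi) (hκ' : κ < Real.pi)
    (hk : KappaEquation κ) {x : E} (hx : x ≠ 0) {M : ℝ} (hM : M ≤ κ) :
    StarConvex ℝ x (logBall x M) := by
  intro z hz a b ha hb hab
  have e1 : planar x z = 1 + planar x (z - x) := by
    have := planar_add_smul hx (z - x) zero_le_one
    rwa [one_smul, add_sub_cancel, Complex.ofReal_one, one_mul] at this
  have hz2 := hz.2
  rw [e1] at hz2
  obtain ⟨h1, h2⟩ := norm_log_lt_of_lt hκ hκ' hk (planar_im_nonneg x (z - x)) (t := b)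
    ⟨hb, by linarith⟩ (by rw [← e1]; exact planar_ne_zero hx hz.1) (hz2.trans_le hM)
  have e2 : a • x + b • z = x + b • (z - x) := by
    rw [← eq_sub_iff_add_eq] at hab
    rw [hab]; module
  rw [← planar_add_smul hx _ hb, ← e2] at h1 h2
  exact ⟨fun h0 => h1 (by rw [h0]; simp [planar, Complex.ext_iff]), h2.trans_lt hz2⟩

theorem add_smul_mem_closure_logBall {κ : ℝ} (hκ : κ ∈ Icc 1 Real.pi) (hκ' : κ < Real.pi)
    (hk : KappaEquation κ) {x z : E} (hx : x ≠ 0) {M : ℝ} (hM : M ≤ κ)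
    (hz : z ∈ closure (logBall x M)) {t : ℝ} (ht : t ∈ Icc (0 : ℝ) 1) :
    x + t • (z - x) ∈ closure (logBall x M) := by
  refine map_mem_closure (f := fun z => x + t • (z - x)) (by fun_prop) hz fun w hw => ?_
  exact (starConvex_logBall hκ hκ' hk hx hM).add_smul_sub_mem hw ht.1 ht.2

theorem planar_eq_zero_iff {x v : E} (hx : x ≠ 0) : planar x v = 0 ↔ v = 0 := by
  rw [← norm_eq_zero, norm_planar hx, div_eq_zero_iff, norm_eq_zero, norm_eq_zero, or_iff_left hx]

/-- Between `x` and the farther boundary point `φ ≤ M ^ 2`, so the nearer one is a local maximum,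
and Rolle gives a second extremum in between. The derivative of `φ` vanishes at both, which forces
the same logarithm and so the same parameter. -/
theorem frontier_logBall_ray_unique {κ : ℝ} (hκ : κ ∈ Icc 1 Real.pi) (hκ' : κ < Real.pi)
    (hk : KappaEquation κ) {x v : E} (hx : x ≠ 0) (hv : v ≠ 0) {M : ℝ} (hM0 : 0 < M) (hM : M ≤ κ)
    {a b : ℝ} (ha : 0 ≤ a) (hab : a < b) (hfa : x + a • v ∈ frontier (logBall x M))
    (hfb : x + b • v ∈ frontier (logBall x M)) : False := by
  have hc0 : planar x v ≠ 0 := (planar_eq_zero_iff hx).not.2 hv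
  have hb0 : 0 < b := ha.trans_lt hab
  have hcl : ∀ t ∈ Icc 0 b, 1 + t * planar x v ≠ 0 ∧
      ‖Complex.log (1 + t * planar x v)‖ ≤ M := by
    intro t ht
    have h1 := add_smul_mem_closure_logBall hκ hκ' hk hx hM (mem_frontier_logBall hx hfb).1
      (t := t / b) ⟨div_nonneg ht.1 hb0.le, (div_le_one hb0).2 ht.2⟩
    rw [add_sub_cancel_left, smul_smul, div_mul_cancel₀ _ hb0.ne'] at h1
    obtain ⟨h2, h3⟩ := mem_closure_logBall hx h1
    rw [planar_add_smul hx v ht.1] at h3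
    refine ⟨?_, h3⟩
    rw [← planar_add_smul hx v ht.1]
    exact planar_ne_zero hx h2
  have hφa : ‖Complex.log (1 + a * planar x v)‖ = M := by
    rw [← planar_add_smul hx v ha]; exact (mem_frontier_logBall hx hfa).2
  have hφb : ‖Complex.log (1 + b * planar x v)‖ = M := by
    rw [← planar_add_smul hx v hb0.le]; exact (mem_frontier_logBall hx hfb).2
  have ha0 : 0 < a := by
    refine lt_of_le_of_ne ha ?_
    rintro rfl
    simp at hφa
    linarith
  set φ := fun t : ℝ => ‖Complex.log (1 + t * planar x v)‖ ^ 2 with hφ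
  have hext : ∀ t ∈ Ioo 0 b, IsLocalExtr φ t →
      Complex.log (1 + t * planar x v) = ⟨-1, √(κ ^ 2 - 1)⟩ := by
    intro t ht h
    obtain ⟨h1, h2⟩ := hcl t ⟨ht.1.le, ht.2.le⟩
    obtain ⟨d, hd, h3⟩ := deriv_norm_log_sq_pos_or hκ hκ' hk hc0 (planar_im_nonneg x v) ht.1 h1
      (h2.trans hM)
    exact (h3.resolve_left fun h4 => h4.ne' (h.hasDerivAt_eq_zero hd)).2
  have hea : IsLocalExtr φ a := by
    refine Or.inr ?_
    filter_upwards [Ioo_mem_nhds ha0 hab] with t ht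
    simp only [hφ, hφa]
    exact pow_le_pow_left₀ (norm_nonneg _) (hcl t ⟨ht.1.le, ht.2.le⟩).2 2
  have hcont : ContinuousOn φ (Icc a b) := by
    intro t ht
    obtain ⟨h1, h2⟩ := hcl t ⟨ha.trans ht.1, ht.2⟩
    obtain ⟨d, hd, -⟩ := hasDerivAt_norm_log_sq (t := t) (c := planar x v)
      (Complex.mem_slitPlane_of_norm_log_lt_pi h1 ((h2.trans hM).trans_lt hκ'))
    exact hd.continuousAt.continuousWithinAt
  obtain ⟨m, hm, hem⟩ := exists_isLocalExtr_Ioo hab hcont (by simp only [hφ, hφa, hφb])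
  have e1 := hext a ⟨ha0, hab⟩ hea
  have e2 := hext m ⟨ha0.trans hm.1, hm.2⟩ hem
  have e3 := congrArg Complex.exp (e1.trans e2.symm)
  rw [Complex.exp_log (hcl a ⟨ha, hab.le⟩).1,
    Complex.exp_log (hcl m ⟨(ha0.trans hm.1).le, hm.2.le⟩).1, add_right_inj,
    mul_left_inj' hc0, Complex.ofReal_inj] at e3
  exact hm.1.ne e3

theorem exists_mem_frontier_ray {S : Set E} (ho : IsOpen S) (hb : Bornology.IsBounded S) {x v : E}
    (hx : x ∈ S) (hv : v ≠ 0) : ∃ t : ℝ, 0 ≤ t ∧ x + t • v ∈ frontier S := by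
  set T : Set ℝ := {t | 0 ≤ t ∧ x + t • v ∈ S} with hT
  have hne : T.Nonempty := ⟨0, le_rfl, by simpa using hx⟩
  have hv0 : 0 < ‖v‖ := norm_pos_iff.2 hv
  have hbdd : BddAbove T := by
    obtain ⟨C, hC⟩ := isBounded_iff_forall_norm_le.1 hb
    refine ⟨(C + ‖x‖) / ‖v‖, fun t ht => ?_⟩
    rw [le_div_iff₀ hv0]
    have h1 := hC _ ht.2
    have h2 := norm_sub_le (x + t • v) x
    rw [add_sub_cancel_left, norm_smul, Real.norm_of_nonneg ht.1] at h2
    linarith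
  have hcont : Continuous fun t : ℝ => x + t • v := by fun_prop
  have h0 : 0 ≤ sSup T := le_csSup hbdd ⟨le_rfl, by simpa using hx⟩
  refine ⟨sSup T, h0, ?_⟩
  rw [ho.frontier_eq]
  refine ⟨map_mem_closure (f := fun t : ℝ => x + t • v) hcont
    (csSup_mem_closure hne hbdd) fun t ht => ht.2, fun h => ?_⟩
  have h1 : ∀ᶠ t in 𝓝[>] (sSup T), x + t • v ∈ S :=
    nhdsWithin_le_nhds (hcont.continuousAt.eventually_mem (ho.mem_nhds h))
  obtain ⟨t, ht, hlt⟩ := (h1.and self_mem_nhdsWithin).exists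
  exact absurd (le_csSup hbdd ⟨h0.trans (le_of_lt hlt), ht⟩) (not_le.2 hlt)

theorem isStrictlyStarlike_logBall {κ : ℝ} (hκ : κ ∈ Icc 1 Real.pi) (hκ' : κ < Real.pi)
    (hk : KappaEquation κ) {x : E} (hx : x ≠ 0) {M : ℝ} (hM0 : 0 < M) (hM : M ≤ κ) :
    IsStrictlyStarlike x (logBall x M) := by
  have hxm := self_mem_logBall hx hM0
  refine ⟨isOpen_logBall hx M,
    ((starConvex_logBall hκ hκ' hk hx hM).isPathConnected hxm).isConnected, hxm,
    isBounded_logBall hx M, fun v hv => ?_⟩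
  obtain ⟨t, ht, hf⟩ := exists_mem_frontier_ray (isOpen_logBall hx M)
    (isBounded_logBall hx M) hxm hv
  refine ⟨x + t • v, ⟨hf, t, ht, rfl⟩, ?_⟩
  rintro _ ⟨hf', s, hs, rfl⟩
  rcases lt_trichotomy s t with h | rfl | h
  · exact (frontier_logBall_ray_unique hκ hκ' hk hx hv hM0 hM hs h hf' hf).elim
  · rfl
  · exact (frontier_logBall_ray_unique hκ hκ' hk hx hv hM0 hM ht h hf hf').elim

/-- The ball contains `-x`, at distance `π`, and the segment from `x` to `-x` passes through `0`. -/
theorem not_starConvex_logBall_of_pi_lt {x : E} (hx : x ≠ 0)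
    (hE : ∃ e : E, inner ℝ x e = 0 ∧ ‖e‖ = ‖x‖) {M : ℝ} (hM : Real.pi < M) :
    ¬ StarConvex ℝ x (logBall x M) := by
  intro hstar
  obtain ⟨e, he, hn⟩ := hE
  have h1 := log_planar_smul_add_smul hx he hn (p := 0) Real.pi_pos.le le_rfl
  have h2 : (Real.exp 0 * Real.cos Real.pi) • x + (Real.exp 0 * Real.sin Real.pi) • e = -x := by
    simp
  rw [h2] at h1
  have hmem : -x ∈ logBall x M := by
    refine ⟨neg_ne_zero.2 hx, ?_⟩
    have h3 : (⟨0, Real.pi⟩ : ℂ) = Real.pi * Complex.I := by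
      apply Complex.ext <;> simp
    rw [h1, h3, norm_mul, Complex.norm_I, mul_one, Complex.norm_real,
      Real.norm_of_nonneg Real.pi_pos.le]
    exact hM
  have h4 := hstar hmem (a := 1 / 2) (b := 1 / 2) (by norm_num) (by norm_num) (by norm_num)
  exact h4.1 (by rw [smul_neg, add_neg_cancel])

theorem eventually_lt_of_hasDerivAt_neg {φ : ℝ → ℝ} {a d : ℝ} (hd : HasDerivAt φ d a) (h : d < 0) :
    ∀ᶠ t in 𝓝[>] a, φ t < φ a := by
  have h1 := (hasDerivAt_iff_tendsto_slope.1 hd).eventually (gt_mem_nhds h)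
  have h2 : ∀ᶠ s in 𝓝[>] a, slope φ a s < 0 :=
    nhdsWithin_mono a (fun s (hs : a < s) => hs.ne') h1
  filter_upwards [h2, self_mem_nhdsWithin] with t ht hat
  rw [slope_def_field, div_neg_iff] at ht
  rw [mem_Ioi] at hat
  rcases ht with h | h <;> linarith [h.1, h.2]

theorem not_starConvex_logBall {κ : ℝ} (hκ : κ ∈ Icc 1 Real.pi)
    (hk : KappaEquation κ) {x : E} (hx : x ≠ 0)
    (hE : ∃ e : E, inner ℝ x e = 0 ∧ ‖e‖ = ‖x‖) {M : ℝ} (hM : κ < M) :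
    ¬ StarConvex ℝ x (logBall x M) := by
  rcases lt_or_ge Real.pi M with hpi | hpi
  · exact not_starConvex_logBall_of_pi_lt hx hE hpi
  intro hstar
  obtain ⟨e, he, hn⟩ := hE
  have hM1 : 1 ≤ M := hκ.1.trans hM.le
  have hC := cosAddMulSin_lt_exp_of_lt hκ hk hM hpi
  have hspi := sqrt_sq_sub_one_lt_pi (p := M) ⟨hM1, hpi⟩
  have hs2 : √(M ^ 2 - 1) ^ 2 = M ^ 2 - 1 := Real.sq_sqrt (by nlinarith)
  have hs0 := Real.sqrt_nonneg (M ^ 2 - 1)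
  set s := √(M ^ 2 - 1) with hs
  -- At `t = 1` the ray reaches the point with logarithm `-1 + i √(M ^ 2 - 1)`, of norm exactly `M`,
  -- where the radial derivative is most negative. Slightly further along, the ray is inside the
  -- ball, while this point is not.
  set v := (Real.exp (-1) * Real.cos s) • x + (Real.exp (-1) * Real.sin s) • e - x with hv
  have hxv : x + (1 : ℝ) • v = (Real.exp (-1) * Real.cos s) • x
      + (Real.exp (-1) * Real.sin s) • e := by rw [one_smul, hv]; abel
  have hlog : Complex.log (1 + (1 : ℝ) * planar x v) = ⟨-1, s⟩ := by
    rw [← planar_add_smul hx v zero_le_one, hxv]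
    exact log_planar_smul_add_smul hx he hn hs0 hspi.le
  set n : ℂ := 1 + (1 : ℝ) * planar x v with hndef
  have hre : Real.log ‖n‖ = -1 := by rw [← Complex.log_re, hlog]
  have him : n.arg = s := by rw [← Complex.log_im, hlog]
  have hn0 : n ≠ 0 := by
    intro h0
    rw [h0] at hre
    simp at hre
  have hnM : ‖Complex.log n‖ = M := by
    refine (sq_eq_sq₀ (norm_nonneg _) (by linarith)).1 ?_
    rw [Complex.sq_norm_log, hre, him, hs2]; ring
  have hslit : n ∈ Complex.slitPlane :=
    Complex.mem_slitPlane_iff_arg.2 ⟨by rw [him]; exact hspi.ne, hn0⟩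
  obtain ⟨d, hd, hd1⟩ := hasDerivAt_norm_log_sq hslit
  rw [← hndef, hre, him, one_mul] at hd1
  have hd0 : d < 0 := by
    rw [hd1]
    refine mul_neg_of_pos_of_neg (by positivity) ?_
    unfold cosAddMulSin at hC
    linarith
  have hev : ∀ᶠ t : ℝ in 𝓝[>] 1, 1 + t * planar x v ∈ Complex.slitPlane := by
    refine nhdsWithin_le_nhds (ContinuousAt.eventually_mem ?_
      (Complex.isOpen_slitPlane.mem_nhds hslit))
    exact Continuous.continuousAt (by fun_prop)
  obtain ⟨t, ⟨ht1, ht2⟩, ht3⟩ :=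
    (((eventually_lt_of_hasDerivAt_neg hd hd0).and hev).and self_mem_nhdsWithin).exists
  replace ht3 : 1 < t := ht3
  have ht0 : 0 < t := by linarith
  have hmem : x + t • v ∈ logBall x M := by
    refine ⟨fun h0 => Complex.slitPlane_ne_zero ht2 ?_, ?_⟩
    · rw [← planar_add_smul hx v ht0.le, h0, planar_eq_zero_iff hx]
    · rw [planar_add_smul hx v ht0.le]
      have := lt_of_pow_lt_pow_left₀ 2 (norm_nonneg _) ht1
      rwa [← hndef, hnM] at this
  have h1 := hstar.add_smul_sub_mem hmem (t := t⁻¹) (by positivity) (inv_le_one_of_one_le₀ ht3.le)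
  rw [add_sub_cancel_left, smul_smul, inv_mul_cancel₀ ht0.ne'] at h1
  have h2 := h1.2
  rw [planar_add_smul hx v zero_le_one, ← hndef, hnM] at h2
  exact lt_irrefl _ h2

end Starlike

theorem exists_orthogonal_norm_eq {n : ℕ} (hn : 2 ≤ n) {x : EuclideanSpace ℝ (Fin n)}
    (hx : x ≠ 0) :
    ∃ e : EuclideanSpace ℝ (Fin n), inner ℝ x e = 0 ∧ ‖e‖ = ‖x‖ := by
  have h1 : Module.finrank ℝ (Submodule.span ℝ {x})
      < Module.finrank ℝ (EuclideanSpace ℝ (Fin n)) := by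
    rw [finrank_euclideanSpace_fin, finrank_span_singleton hx]
    omega
  obtain ⟨w, hw, hw0⟩ := Submodule.exists_mem_ne_zero_of_ne_bot (p := (Submodule.span ℝ {x})ᗮ)
    fun h => by
      rw [Submodule.orthogonal_eq_bot_iff] at h
      rw [h, finrank_top] at h1
      exact lt_irrefl _ h1
  have hw' : ‖w‖ ≠ 0 := norm_ne_zero_iff.2 hw0
  refine ⟨(‖x‖ / ‖w‖) • w, ?_, ?_⟩
  · rw [inner_smul_right, Submodule.mem_orthogonal_singleton_iff_inner_right.1 hw, mul_zero]
  · rw [norm_smul, Real.norm_of_nonneg (by positivity)]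
    field_simp

theorem quasihyperbolicBall_compl_zero_eq {E : Type*} [NormedAddCommGroup E]
    [InnerProductSpace ℝ E] {x : E} (hx : x ≠ 0) (hE : ∃ e : E, inner ℝ x e = 0 ∧ ‖e‖ = ‖x‖)
    (M : ℝ) : quasihyperbolicBall ({0}ᶜ : Set E) x M = logBall x M :=
  ext fun _ => mem_quasihyperbolicBall_compl_zero hx hE

end Development

theorem theorem1p1 :
    ∃ κ : ℝ, κ ∈ Set.Icc 1 Real.pi ∧ KappaEquation κ ∧
      (∀ p ∈ Set.Icc 1 Real.pi, KappaEquation p → p = κ) ∧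
      |κ - 2.83297| ≤ 0.000005 ∧
      ∀ n : ℕ, 2 ≤ n → ∀ x : EuclideanSpace ℝ (Fin n), x ≠ 0 → ∀ M : ℝ,
        (0 < M → M ≤ 1 →
          IsStrictlyConvex (quasihyperbolicBall ({0}ᶜ : Set (EuclideanSpace ℝ (Fin n))) x M)) ∧
        (1 < M →
          ¬ Convex ℝ (quasihyperbolicBall ({0}ᶜ : Set (EuclideanSpace ℝ (Fin n))) x M)) ∧
        (0 < M → M ≤ κ →
          IsStrictlyStarlike x
            (quasihyperbolicBall ({0}ᶜ : Set (EuclideanSpace ℝ (Fin n))) x M)) ∧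
        (κ < M →
          ¬ StarConvex ℝ x
            (quasihyperbolicBall ({0}ᶜ : Set (EuclideanSpace ℝ (Fin n))) x M)) := by
  obtain ⟨κ, hκ, hk, huniq, hnum⟩ := exists_kappa
  have hκ' : κ < Real.pi := by linarith [(abs_le.1 hnum).2, Real.pi_gt_three]
  refine ⟨κ, hκ, hk, huniq, hnum, fun n hn x hx M => ?_⟩
  have hE := exists_orthogonal_norm_eq hn hx
  rw [quasihyperbolicBall_compl_zero_eq hx hE]
  exact ⟨fun _ hM => isStrictlyConvex_logBall hx hM, fun hM => not_convex_logBall hx hE hM,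
    fun hM0 hM => isStrictlyStarlike_logBall hκ hκ' hk hx hM0 hM,
    fun hM => not_starConvex_logBall hκ hk hx hE hM⟩
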